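/- Let $\mathcal D=C_c^\infty(\mathbb R,\mathbb C)$, let $\mathcal D'$ be the space of distributions on $\mathbb R$, and $\mathcal S,\mathcal S'$ the spaces of Schwartz functions and of tempered distributions. For $f\in L^1_{\rm loc}(\mathbb R,\mathbb C)$ let $\iota(f)\in\mathcal D'$ be the distribution $\varphi\mapsto\int_{\mathbb R} f\varphi\,dt$. For $Y\in\mathcal D'$ let $R=Y*$ be the convolution operator with defining distribution $Y$. Its domain consists of all $U\in\mathcal D'$ for which the convolution $Y*U$, given by $\langle Y*U,\varphi\rangle=\langle Y\otimes U,\varphi(t_1+t_2)\rangle$, exists, i.e. for which $\lim_{k}\langle Y\otimes U,\eta_k(t_1,t_2)\varphi(t_1+t_2)\rangle$ exists for every $\varphi\in\mathcal D$ and every sequence $\eta_k\in C_c^\infty(\mathbb R^2)$ that is eventually $1$ on each compact set and has all derivatives bounded uniformly in $k$, and does not depend on the sequence. $R$ is called real if it maps real distributions in its domain to real distributions, where a distribution is real if it takes real values on real-valued test functions. Let $N\in\mathbb N_0$ and $\vec c,\vec d\in\mathbb R^{N+1}$. Suppose that $R=Y*$ is a pseudo-passive causal operator of slow growth with data $N,\vec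 c,\vec d$, that is: (a) (pseudo-passivity) for every $\varphi\in\mathcal D$ one has $R(\iota(\varphi))=\iota(\psi)$ with some $\psi\in\mathcal D$ (if $\vec d=\vec 0$, it is only required that $\psi\in L^1_{\rm loc}$), and for all $t\in\mathbb R$ $$\operatorname{Re}\Big[\int_{-\infty}^t\overline{\varphi(\tau)}\,\psi(\tau)\,d\tau\Big]\ \ge\ \sum_{j=0}^N\int_{-\infty}^t\big(c_j|\varphi^{(j)}(\tau)|^2+d_j|\psi^{(j)}(\tau)|^2\big)\,d\tau ,$$ where the terms with $\psi^{(j)}$ are absent if $\vec d=\vec 0$; (b) (causality) $\operatorname{supp}Y\subseteq[0,\infty)$; (c) (slow growth) $Y\in\mathcal S'$. Then the Laplace transform $W=\mathcal L(Y)$ exists at every $s\in\mathbb C$ with $\operatorname{Re}s>0$, where $$\mathcal L(Y)(s)=\big\langle e^{-c\tau}Y,\ \xi\mapsto\rho(\xi)e^{-(s-c)\xi}\big\rangle$$ for any real $c<\operatorname{Re}s$ with $e^{-c\tau}Y\in\mathcal S'$ and any smooth $\rho$ with support bounded on the left such that $\rho=1$ on a neighbourhood of $\operatorname{supp}Y$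 and $\rho(\xi)e^{-(s-c)\xi}$ is a Schwartz function; such choices exist and the value does not depend on them. Moreover, $W$ is holomorphic on $\{s\in\mathbb C:\operatorname{Re}s>0\}$ and satisfies there $$\operatorname{Re}W(s)\ \ge\ \sum_{j=0}^N|s|^{2j}\big(c_j+d_j|W(s)|^2\big).$$ If, in addition, $R$ is real, then $W(s)\in\mathbb R$ for all $s\in(0,\infty)$. -/

import Mathlib

open Set Filter Topology MeasureTheory TopologicalSpace
open scoped Distributions SchwartzMap ContDiff

noncomputable section

namespace PseudoPassive

/-! ### Test functions and distributions -/

/-- Complex valued test functions on the whole space `E`, i.e. `C_c^∞(E, ℂ)` with its usual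
LF topology. -/
abbrev Test (E : Type) [NormedAddCommGroup E] [NormedSpace ℝ E] : Type :=
  𝓓((⊤ : Opens E), ℂ)

/-- Distributions: continuous `ℂ`-linear functionals on complex valued test functions. -/
abbrev Distr (E : Type) [NormedAddCommGroup E] [NormedSpace ℝ E] : Type :=
  Test E →L[ℂ] ℂ

/-- The regular distribution `ι(f) = T_f`, `φ ↦ ∫ φ(t) f(t) dt`, of a function `f`. It is only used
for locally integrable `f`. -/
def regular (f : ℝ → ℂ) : Distr ℝ :=
  TestFunction.integralAgainstBilinCLM (ContinuousLinearMap.mul ℂ ℂ) volume f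

theorem regular_apply {f : ℝ → ℂ} (hf : LocallyIntegrable f volume) (φ : Test ℝ) :
    regular f φ = ∫ t, φ t * f t := by
  unfold regular
  rw [TestFunction.integralAgainstBilinCLM_eq_integral]
  · rfl
  · exact hf.locallyIntegrableOn _

/-- A distribution is real if it takes real values on real valued test functions. -/
def IsReal (U : Distr ℝ) : Prop :=
  ∀ φ : Test ℝ, (∀ x, (φ x).im = 0) → (U φ).im = 0

/-- The product `g U` of a smooth function and a distribution, `⟨g U, φ⟩ = ⟨U, g φ⟩`. -/
def smoothMul (g : ℝ → ℂ) (hg : ContDiff ℝ ∞ g) (U : Distr ℝ) : Distr ℝ :=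
  U ∘L TestFunction.limitCLM ℂ
    (fun φ : Test ℝ ↦
      (⟨fun x ↦ φ x * g x, φ.contDiff.mul hg, φ.hasCompactSupport.mul_right,
        fun _ _ ↦ trivial⟩ : Test ℝ))
    (fun _ hK ↦ TestFunction.ofSupportedInCLM ℂ hK ∘L
      ContDiffMapSupportedIn.bilinLeftCLM (ContinuousLinearMap.mul ℂ ℂ) hg)
    (fun _ _ _ ↦ rfl)

/-- The distribution `(τ ↦ e^{-cτ}) U`. -/
def expWeight (c : ℝ) (U : Distr ℝ) : Distr ℝ :=
  smoothMul (fun τ : ℝ ↦ Complex.exp (-(c * τ : ℂ)))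
    ((contDiff_const.mul Complex.ofRealCLM.contDiff).neg.cexp) U

/-- A test function as a Schwartz function. -/
def toSchwartz (φ : Test ℝ) : 𝓢(ℝ, ℂ) :=
  φ.hasCompactSupport.toSchwartzMap φ.contDiff

/-- The tempered distribution `T` restricts to `U` on test functions. -/
def Extends (T : 𝓢'(ℝ, ℂ)) (U : Distr ℝ) : Prop :=
  ∀ φ : Test ℝ, T (toSchwartz φ) = U φ

/-- `U ∈ 𝓢'`. -/
def IsTempered (U : Distr ℝ) : Prop :=
  ∃ T : 𝓢'(ℝ, ℂ), Extends T U

/-- The support of a distribution. -/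
def supp (U : Distr ℝ) : Set ℝ := Distribution.dsupport (U : Test ℝ → ℂ)

/-- Right-sided distributions: the support is contained in some half-line `[t, ∞)`. -/
def IsRightSided (U : Distr ℝ) : Prop :=
  ∃ t : ℝ, supp U ⊆ Ici t

/-! ### Laplace transform -/

/-- The choices entering the value at `s` of the Laplace transform of `U`: a number `c < Re s` and
an element `T` of `𝓢'` which is `e^{-cτ} U`, a smooth function `ρ` whose support is bounded on the
left and which equals one on a neighbourhood of the support of `U`, such that
`θ(ξ) = ρ(ξ) e^{-(s-c)ξ}` is a Schwartz function. -/
structure LaplaceData (U : Distr ℝ) (s : ℂ) (c : ℝ) (T : 𝓢'(ℝ, ℂ)) (ρ : ℝ → ℂ)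
    (θ : 𝓢(ℝ, ℂ)) : Prop where
  lt_re : c < s.re
  tempered : Extends T (expWeight c U)
  smooth : ContDiff ℝ ∞ ρ
  bddBelow : BddBelow (Function.support ρ)
  eq_one : ∀ᶠ x in 𝓝ˢ (supp U), ρ x = 1
  eq_mul : ∀ ξ : ℝ, θ ξ = ρ ξ * Complex.exp (-((s - c) * ξ))

/-- The Laplace transform of the right-sided distribution `U` exists at `s` and has the value `w`:
admissible choices exist, and all of them give
`⟨e^{-cτ} U, ξ ↦ ρ(ξ) e^{-(s-c)ξ}⟩ = w`. -/
def HasLaplaceAt (U : Distr ℝ) (s w : ℂ) : Prop :=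
  IsRightSided U ∧ (∃ c T ρ θ, LaplaceData U s c T ρ θ) ∧
    ∀ c T ρ θ, LaplaceData U s c T ρ θ → T θ = w

theorem HasLaplaceAt.unique {U : Distr ℝ} {s w w' : ℂ} (h : HasLaplaceAt U s w)
    (h' : HasLaplaceAt U s w') : w = w' := by
  obtain ⟨c, T, ρ, θ, hd⟩ := h.2.1
  exact (h.2.2 c T ρ θ hd).symm.trans (h'.2.2 c T ρ θ hd)

/-! ### Direct product -/

/-- The partial function `t₂ ↦ Ψ(t₁, t₂)` of a test function in two variables. -/
def slice (Ψ : Test (ℝ × ℝ)) (t₁ : ℝ) : Test ℝ where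
  toFun := fun t₂ ↦ Ψ (t₁, t₂)
  contDiff' := Ψ.contDiff.comp (contDiff_const.prodMk contDiff_id)
  hasCompactSupport' := by
    refine HasCompactSupport.intro (Ψ.hasCompactSupport.isCompact.image continuous_snd) ?_
    intro x hx
    by_contra h
    exact hx ⟨(t₁, x), subset_tsupport _ h, rfl⟩
  tsupport_subset' := fun _ _ ↦ trivial

@[simp] theorem slice_apply (Ψ : Test (ℝ × ℝ)) (t₁ t₂ : ℝ) : slice Ψ t₁ t₂ = Ψ (t₁, t₂) := rfl

/-- Partial derivatives of test functions in two variables. -/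
def pd (v : ℝ × ℝ) (Ψ : Test (ℝ × ℝ)) : Test (ℝ × ℝ) := TestFunction.lineDerivCLM ℂ v Ψ

theorem pd_apply (v : ℝ × ℝ) (Ψ : Test (ℝ × ℝ)) (z : ℝ × ℝ) : pd v Ψ z = fderiv ℝ Ψ z v := by
  unfold pd
  rw [TestFunction.lineDerivCLM_eq_fderivCLM, TestFunction.fderivCLM_apply]
  simp

theorem differentiable_test (Ψ : Test (ℝ × ℝ)) : Differentiable ℝ Ψ :=
  Ψ.contDiff.differentiable (by simp)

theorem hasDerivAt_fst (Ψ : Test (ℝ × ℝ)) (t y : ℝ) :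
    HasDerivAt (fun u ↦ Ψ (u, y)) (pd (1, 0) Ψ (t, y)) t := by
  rw [pd_apply]
  exact (differentiable_test Ψ (t, y)).hasFDerivAt.comp_hasDerivAt t
    ((hasDerivAt_id t).prodMk (hasDerivAt_const t y))

theorem hasDerivAt_snd (Ψ : Test (ℝ × ℝ)) (t y : ℝ) :
    HasDerivAt (fun u ↦ Ψ (t, u)) (pd (0, 1) Ψ (t, y)) y := by
  rw [pd_apply]
  exact (differentiable_test Ψ (t, y)).hasFDerivAt.comp_hasDerivAt y
    ((hasDerivAt_const y t).prodMk (hasDerivAt_id y))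

theorem pd_comm (v w : ℝ × ℝ) (Ψ : Test (ℝ × ℝ)) : pd v (pd w Ψ) = pd w (pd v Ψ) := by
  have key : ∀ (a b : ℝ × ℝ) (z : ℝ × ℝ),
      pd a (pd b Ψ) z = fderiv ℝ (fderiv ℝ Ψ) z a b := by
    intro a b z
    rw [pd_apply]
    have h1 : (pd b Ψ : ℝ × ℝ → ℂ) = fun z ↦ fderiv ℝ Ψ z b := by
      ext z; exact pd_apply b Ψ z
    rw [h1]
    have h2 : DifferentiableAt ℝ (fderiv ℝ Ψ) z :=
      (Ψ.contDiff.fderiv_right (m := 1) (by norm_cast)).differentiable (by simp) z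
    rw [fderiv_clm_apply h2 (differentiableAt_const b)]
    simp
  ext z
  rw [key, key]
  have hs : IsSymmSndFDerivAt ℝ Ψ z := by
    apply ContDiffAt.isSymmSndFDerivAt (n := ∞)
    · exact Ψ.contDiff.contDiffAt
    · simp only [minSmoothness_of_isRCLikeNormedField]
      exact WithTop.coe_le_coe.2 le_top
  exact hs v w

theorem iteratedDeriv_slice (j : ℕ) : ∀ (Ψ : Test (ℝ × ℝ)) (t y : ℝ),
    iteratedDeriv j (slice Ψ t) y = ((pd (0, 1))^[j] Ψ) (t, y) := by
  induction j with
  | zero => intro Ψ t y; simp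
  | succ j ih =>
    intro Ψ t y
    rw [iteratedDeriv_succ', Function.iterate_succ_apply, ← ih]
    congr 1
    ext x
    exact (hasDerivAt_snd Ψ t x).deriv

theorem pd_iterate_comm (j : ℕ) (Ψ : Test (ℝ × ℝ)) :
    (pd (0, 1))^[j] (pd (1, 0) Ψ) = pd (1, 0) ((pd (0, 1))^[j] Ψ) :=
  ((Function.Commute.iterate_left (fun Ψ ↦ pd_comm (0, 1) (1, 0) Ψ) j) Ψ)

theorem taylor_fst (Φ : Test (ℝ × ℝ)) : ∃ M : ℝ, 0 ≤ M ∧ ∀ t h y : ℝ,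
    ‖Φ (t + h, y) - Φ (t, y) - h * pd (1, 0) Φ (t, y)‖ ≤ M * h ^ 2 := by
  obtain ⟨M, hM⟩ := (pd (1, 0) (pd (1, 0) Φ)).continuous.bounded_above_of_compact_support
    (pd (1, 0) (pd (1, 0) Φ)).hasCompactSupport
  have hM0 : 0 ≤ M := (norm_nonneg _).trans (hM 0)
  have lip : ∀ t u y : ℝ, ‖pd (1, 0) Φ (t + u, y) - pd (1, 0) Φ (t, y)‖ ≤ M * |u| := by
    intro t u y
    have := convex_univ.norm_image_sub_le_of_norm_hasDerivWithin_le
      (f := fun u ↦ pd (1, 0) Φ (u, y)) (C := M) (x := t) (y := t + u)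
      (fun x _ ↦ (hasDerivAt_fst (pd (1, 0) Φ) x y).hasDerivWithinAt)
      (fun x _ ↦ hM (x, y)) (mem_univ _) (mem_univ _)
    simpa using this
  refine ⟨M, hM0, fun t h y ↦ ?_⟩
  have hd : ∀ u : ℝ, HasDerivAt
      (fun u : ℝ ↦ Φ (t + u, y) - u * pd (1, 0) Φ (t, y))
      (pd (1, 0) Φ (t + u, y) - pd (1, 0) Φ (t, y)) u := by
    intro u
    have h1 : HasDerivAt (fun u : ℝ ↦ Φ (t + u, y)) (pd (1, 0) Φ (t + u, y)) u :=
      HasDerivAt.comp_const_add t u (hasDerivAt_fst Φ (t + u) y)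
    have h2 : HasDerivAt (fun u : ℝ ↦ (u : ℂ) * pd (1, 0) Φ (t, y)) (pd (1, 0) Φ (t, y)) u := by
      simpa using (Complex.ofRealCLM.hasDerivAt (x := u)).mul_const (pd (1, 0) Φ (t, y))
    exact h1.sub h2
  have := (convex_uIcc (0 : ℝ) h).norm_image_sub_le_of_norm_hasDerivWithin_le
      (f := fun u : ℝ ↦ Φ (t + u, y) - u * pd (1, 0) Φ (t, y)) (C := M * |h|) (x := 0) (y := h)
      (fun x _ ↦ (hd x).hasDerivWithinAt)
      (fun x hx ↦ (lip t x y).trans (by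
        have := abs_sub_left_of_mem_uIcc hx
        rw [sub_zero, sub_zero] at this
        exact mul_le_mul_of_nonneg_left this hM0)) left_mem_uIcc right_mem_uIcc
  have e : M * |h| * ‖h - 0‖ = M * h ^ 2 := by
    rw [sub_zero, Real.norm_eq_abs, mul_assoc, ← sq, sq_abs]
  rw [e] at this
  refine le_trans (le_of_eq ?_) this
  congr 1
  simp only [add_zero, Complex.ofReal_zero, zero_mul, sub_zero]
  ring

theorem hasDerivAt_pairing (U : Distr ℝ) (Ψ : Test (ℝ × ℝ)) (t : ℝ) :
    HasDerivAt (fun t ↦ U (slice Ψ t)) (U (slice (pd (1, 0) Ψ) t)) t := by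
  let K : Compacts ℝ := ⟨Prod.snd '' tsupport Ψ, Ψ.hasCompactSupport.isCompact.image continuous_snd⟩
  have hK : (K : Set ℝ) ⊆ (⊤ : Opens ℝ) := fun _ _ ↦ trivial
  let UK : 𝓓_{K}(ℝ, ℂ) →L[ℂ] ℂ := U ∘L TestFunction.ofSupportedInCLM ℂ hK
  obtain ⟨s, C, -, hC⟩ := Seminorm.bound_of_continuous
    (ContDiffMapSupportedIn.withSeminorms ℂ ℝ ℂ ⊤ K)
    ((normSeminorm ℂ ℂ).comp UK.toLinearMap) (continuous_norm.comp UK.continuous)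
  choose M hM0 hM using fun j : ℕ ↦ taylor_fst ((pd (0, 1))^[j] Ψ)
  have bound : ∀ h : ℝ,
      ‖U (slice Ψ (t + h)) - U (slice Ψ t) - h * U (slice (pd (1, 0) Ψ) t)‖
        ≤ C * (∑ j ∈ s, M j) * ‖h ^ 2‖ := by
    intro h
    let G : Test ℝ := slice Ψ (t + h) - slice Ψ t - (h : ℂ) • slice (pd (1, 0) Ψ) t
    have hG : ∀ x, G x = Ψ (t + h, x) - Ψ (t, x) - h * pd (1, 0) Ψ (t, x) := fun x ↦ rfl
    have hsupp : Function.support G ⊆ K := by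
      intro x hx
      by_contra hxK
      have h0 : ∀ r : ℝ, (r, x) ∉ tsupport Ψ := fun r hr ↦ hxK ⟨(r, x), hr, rfl⟩
      have h1 : ∀ r : ℝ, Ψ (r, x) = 0 := fun r ↦ image_eq_zero_of_notMem_tsupport (h0 r)
      apply hx
      rw [hG, h1, h1, pd_apply,
        image_eq_zero_of_notMem_tsupport (fun hh ↦ h0 t (tsupport_fderiv_subset ℝ hh))]
      simp
    let g : 𝓓_{K}(ℝ, ℂ) := ContDiffMapSupportedIn.of_support_subset G.contDiff hsupp
    have hUg : UK g = U (slice Ψ (t + h)) - U (slice Ψ t) - h * U (slice (pd (1, 0) Ψ) t) := by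
      have : UK g = U G := rfl
      rw [this]
      simp [G]
    have hder : ∀ j x, ‖iteratedFDeriv ℝ j g x‖ ≤ M j * h ^ 2 := by
      intro j x
      rw [norm_iteratedFDeriv_eq_norm_iteratedDeriv]
      have : iteratedDeriv j g x = iteratedDeriv j (slice Ψ (t + h)) x
          - iteratedDeriv j (slice Ψ t) x - h * iteratedDeriv j (slice (pd (1, 0) Ψ) t) x := by
        have e : (g : ℝ → ℂ) = (slice Ψ (t + h) : ℝ → ℂ) - (slice Ψ t : ℝ → ℂ)
          - (h : ℂ) • (slice (pd (1, 0) Ψ) t : ℝ → ℂ) := rfl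
        have cd : ∀ φ : Test ℝ, ContDiffAt ℝ j φ x := fun φ ↦
          (φ.contDiff.of_le (by exact_mod_cast le_top)).contDiffAt
        have e1 := iteratedDeriv_sub (n := j) (x := x) ((cd (slice Ψ (t + h))).sub (cd (slice Ψ t)))
          ((cd (slice (pd (1, 0) Ψ) t)).const_smul (h : ℂ))
        have e2 := iteratedDeriv_sub (cd (slice Ψ (t + h))) (cd (slice Ψ t))
        have e3 := iteratedDeriv_const_smul_field (n := j) (x := x) (h : ℂ)
          (slice (pd (1, 0) Ψ) t : ℝ → ℂ)
        rw [e]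
        refine e1.trans ?_
        exact congrArg₂ (· - ·) e2 e3
      rw [this, iteratedDeriv_slice, iteratedDeriv_slice, iteratedDeriv_slice, pd_iterate_comm]
      exact hM j t h x
    have hsem : (s.sup (ContDiffMapSupportedIn.seminorm ℂ ℝ ℂ ⊤ K)) g ≤ (∑ j ∈ s, M j) * h ^ 2 := by
      apply Seminorm.finset_sup_apply_le
      · exact mul_nonneg (Finset.sum_nonneg fun j _ ↦ hM0 j) (sq_nonneg h)
      · intro j hj
        rw [ContDiffMapSupportedIn.seminorm_top_le_iff ℂ
          (mul_nonneg (Finset.sum_nonneg fun j _ ↦ hM0 j) (sq_nonneg h))]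
        intro x _
        refine (hder j x).trans ?_
        gcongr
        exact Finset.single_le_sum (fun j _ ↦ hM0 j) hj
    rw [← hUg]
    calc ‖UK g‖ ≤ C * (s.sup (ContDiffMapSupportedIn.seminorm ℂ ℝ ℂ ⊤ K)) g := hC g
      _ ≤ C * ((∑ j ∈ s, M j) * h ^ 2) := by gcongr
      _ = C * (∑ j ∈ s, M j) * ‖h ^ 2‖ := by
        rw [Real.norm_of_nonneg (sq_nonneg h), mul_assoc]
  rw [hasDerivAt_iff_isLittleO_nhds_zero]
  have hO : (fun h : ℝ ↦ U (slice Ψ (t + h)) - U (slice Ψ t)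
      - h • U (slice (pd (1, 0) Ψ) t)) =O[𝓝 0] fun h : ℝ ↦ h ^ 2 :=
    Asymptotics.IsBigO.of_bound _ (Eventually.of_forall fun h ↦ by
      simpa only [Complex.real_smul] using bound h)
  refine hO.trans_isLittleO ?_
  simpa using Asymptotics.isLittleO_pow_id (𝕜 := ℝ) (n := 2) one_lt_two

/-- The test function `t₁ ↦ ⟨U, t₂ ↦ Ψ(t₁, t₂)⟩`. -/
def pairing (U : Distr ℝ) (Ψ : Test (ℝ × ℝ)) : Test ℝ where
  toFun := fun t₁ ↦ U (slice Ψ t₁)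
  contDiff' := by
    have main : ∀ (n : ℕ) (Ψ : Test (ℝ × ℝ)), ContDiff ℝ n (fun t₁ ↦ U (slice Ψ t₁)) := by
      intro n
      induction n with
      | zero =>
        intro Ψ
        exact contDiff_zero.2
          (continuous_iff_continuousAt.2 fun t ↦ (hasDerivAt_pairing U Ψ t).continuousAt)
      | succ n ih =>
        intro Ψ
        have hd : deriv (fun t₁ ↦ U (slice Ψ t₁)) = fun t₁ ↦ U (slice (pd (1, 0) Ψ) t₁) := by
          ext t; exact (hasDerivAt_pairing U Ψ t).deriv
        rw [show ((n + 1 : ℕ) : WithTop ℕ∞) = (n : WithTop ℕ∞) + 1 by norm_cast,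
          contDiff_succ_iff_deriv]
        refine ⟨fun t ↦ (hasDerivAt_pairing U Ψ t).differentiableAt, by simp, ?_⟩
        rw [hd]
        exact ih _
    exact contDiff_infty.2 fun n ↦ main n Ψ
  hasCompactSupport' := by
    refine HasCompactSupport.intro (Ψ.hasCompactSupport.isCompact.image continuous_fst) ?_
    intro x hx
    have : slice Ψ x = 0 := by
      ext y
      by_contra h
      exact hx ⟨(x, y), subset_tsupport _ h, rfl⟩
    rw [this, map_zero]
  tsupport_subset' := fun _ _ ↦ trivial

/-- The direct product: `⟨V ⊗ U, Ψ⟩ = ⟨V, t₁ ↦ ⟨U, t₂ ↦ Ψ(t₁, t₂)⟩⟩`. -/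
def directProduct (V U : Distr ℝ) (Ψ : Test (ℝ × ℝ)) : ℂ := V (pairing U Ψ)

/-! ### Convolution -/

/-- Test functions `η k` on the plane converging to the constant `1`: every compact set is
eventually contained in `{η k = 1}`, and all derivatives are bounded uniformly in `k`. -/
structure IsUnitSequence (η : ℕ → Test (ℝ × ℝ)) : Prop where
  eventually_one : ∀ K : Set (ℝ × ℝ), IsCompact K → ∀ᶠ k in atTop, ∀ z ∈ K, η k z = 1
  bounded : ∀ m : ℕ, ∃ C : ℝ, ∀ k z, ‖iteratedFDeriv ℝ m (η k) z‖ ≤ C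

/-- The test function `(t₁, t₂) ↦ η(t₁, t₂) φ(t₁ + t₂)`. -/
def cutSum (η : Test (ℝ × ℝ)) (φ : Test ℝ) : Test (ℝ × ℝ) where
  toFun := fun z ↦ η z * φ (z.1 + z.2)
  contDiff' := η.contDiff.mul (φ.contDiff.comp (contDiff_fst.add contDiff_snd))
  hasCompactSupport' := η.hasCompactSupport.mul_right
  tsupport_subset' := fun _ _ ↦ trivial

/-- The convolution `V * U` exists and equals `Z`. Since `(t₁, t₂) ↦ φ(t₁ + t₂)` does not have
compact support, the value `⟨V ⊗ U, (t₁, t₂) ↦ φ(t₁ + t₂)⟩` is the limit of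
`⟨V ⊗ U, (t₁, t₂) ↦ η_k(t₁, t₂) φ(t₁ + t₂)⟩`, which is required to exist and to be the same for all
sequences `η_k` of cut-off functions converging to `1`. -/
def IsConvolution (V U Z : Distr ℝ) : Prop :=
  ∀ η : ℕ → Test (ℝ × ℝ), IsUnitSequence η → ∀ φ : Test ℝ,
    Tendsto (fun k ↦ directProduct V U (cutSum (η k) φ)) atTop (𝓝 (Z φ))

/-! ### Convolution operators

The convolution operator `R = Y *` is given by its defining distribution `Y`; its domain consists
of all `U` for which `Y * U` exists, and `R(U) = Z` means `IsConvolution Y U Z`. -/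

/-- The convolution operator `Y *` is real: it maps real distributions in its domain to real
distributions. -/
def IsRealOperator (Y : Distr ℝ) : Prop :=
  ∀ U Z : Distr ℝ, IsReal U → IsConvolution Y U Z → IsReal Z

/-- Pseudo-passivity of `R = Y *` with data `N`, `c`, `d`: for each test function `φ`, `R(ι(φ))` is
`ι(ψ)` for a locally integrable `ψ`, which has to be a test function unless `d = 0`, and the
inequality holds for all `t`. If `d = 0` the terms with derivatives of `ψ` vanish. -/
def IsPseudoPassive (Y : Distr ℝ) (N : ℕ) (c d : Fin (N + 1) → ℝ) : Prop :=
  ∀ φ : Test ℝ, ∃ ψ : ℝ → ℂ, LocallyIntegrable ψ volume ∧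
    IsConvolution Y (regular φ) (regular ψ) ∧
    (d ≠ 0 → ∃ χ : Test ℝ, ψ = χ) ∧
    ∀ t : ℝ,
      ∑ j : Fin (N + 1), ∫ τ in Iic t,
          (c j * ‖iteratedDeriv j φ τ‖ ^ 2 + d j * ‖iteratedDeriv j ψ τ‖ ^ 2)
        ≤ (∫ τ in Iic t, starRingEnd ℂ (φ τ) * ψ τ).re

/-- `R = Y *` is a pseudo-passive causal operator of slow growth with data `N`, `c`, `d`. -/
structure IsPseudoPassiveCausalSlowGrowth (Y : Distr ℝ) (N : ℕ) (c d : Fin (N + 1) → ℝ) :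
    Prop where
  pseudoPassive : IsPseudoPassive Y N c d
  causal : supp Y ⊆ Ici 0
  slowGrowth : IsTempered Y

end PseudoPassive

end

/-!
Let `T` be a tempered distribution extending `Y`, and let `ρ` be a smooth cut-off function which is
`1` on `[-1, ∞)` and `0` on `(-∞, -2]`. For `0 < Re s` the kernel `ξ ↦ ρ(ξ) e^{-sξ}` is a Schwartz
function, and the Laplace transform is `W(s) = ⟨T, ρ e^{-s·}⟩`.

Everything is reduced to one estimate for `T`: if `f i` is a family of smooth functions all of whose
derivatives are bounded uniformly in `i`, then `T (f i θ)` is bounded in `i`, and it is `O(1 / r)` if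
`f i θ` vanishes on `(-r, r)` (`exists_tempered_mul_bound`, `exists_tempered_tail_bound`).

* Independence of the choices (`hasLaplaceAt_kernel`): by this estimate the value of a tempered
  distribution on a Schwartz function is the limit of its values on truncations. On truncated kernels
  all choices reduce to values of `Y` on test functions which agree near the support of `Y`.
* Holomorphy (`differentiableOn_tempered_kernel`): the Schwartz seminorms of the kernel are bounded
  locally uniformly in `s`, and every derivative of the kernel at a point is holomorphic in `s`. By
  the Schwarz lemma the difference quotients in `s` are then Cauchy in each seminorm.
* Identification of `Y * φ` (`IsConvolution.ae_eq_conv`): testing `Y * φ` with bump functions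
  shrinking to `x` shows that the density of `Y * φ` is almost everywhere the smooth function
  `x ↦ ⟨Y, φ(x - ·)⟩`. Hence the inequality of pseudo-passivity holds for that function
  (`IsPseudoPassive.conv_inequality`).
* The inequality for `W` (`IsPseudoPassive.laplace_inequality`): apply pseudo-passivity with `t = 0`
  to `φ_n(τ) = a_n(τ) e^{sτ}` with `a_n = 1` on `[-n, 2]`. By causality
  `(Y * φ_n)(x) = e^{sx} ⟨T, a_n(x - ·) ρ e^{-s·}⟩`, so the estimate gives
  `|Y * φ_n| ≤ C e^{Re s x}` and `Y * φ_n → W(s) e^{sx}` for `x ≤ 0`. The same holds for derivatives,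
  as `(a e^{s·})' = (a' + s a) e^{s·}`. Dominated convergence on `(-∞, 0]` yields the inequality for
  `W`, multiplied by `∫_{-∞}^0 e^{2 Re s τ} dτ > 0`.
* Reality: for real `s` the functions `φ_n` are real, and `(Y * φ_n)(0) → W(s)`.
-/

noncomputable section

namespace PseudoPassive

/-! ### Families of smooth functions with uniform bounds -/

/-- A family of smooth functions on the line each of whose derivatives is bounded uniformly in the
point and in the index. -/
structure UniformlySmooth {ι : Type*} (f : ι → ℝ → ℂ) : Prop where
  contDiff : ∀ i, ContDiff ℝ ∞ (f i)
  bounded : ∀ m : ℕ, ∃ C : ℝ, ∀ i x, ‖iteratedDeriv m (f i) x‖ ≤ C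

theorem contDiffAt_nat {f : ℝ → ℂ} (hf : ContDiff ℝ ∞ f) (n : ℕ) (x : ℝ) : ContDiffAt ℝ n f x :=
  (hf.of_le (by exact_mod_cast le_top)).contDiffAt

theorem contDiff_deriv {f : ℝ → ℂ} (hf : ContDiff ℝ ∞ f) : ContDiff ℝ ∞ (deriv f) :=
  (contDiff_infty_iff_deriv.1 hf).2

namespace UniformlySmooth

variable {ι κ : Type*} {f g : ι → ℝ → ℂ}

theorem mul (hf : UniformlySmooth f) (hg : UniformlySmooth g) :
    UniformlySmooth fun i x ↦ f i x * g i x := by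
  refine ⟨fun i ↦ (hf.contDiff i).mul (hg.contDiff i), fun m ↦ ?_⟩
  choose A hA using hf.bounded
  choose B hB using hg.bounded
  refine ⟨∑ i ∈ Finset.range (m + 1), m.choose i * A i * B (m - i), fun i x ↦ ?_⟩
  rw [iteratedDeriv_fun_mul (contDiffAt_nat (hf.contDiff i) m x)
    (contDiffAt_nat (hg.contDiff i) m x)]
  refine (norm_sum_le _ _).trans (Finset.sum_le_sum fun k _ ↦ ?_)
  rw [norm_mul, norm_mul, Complex.norm_natCast]
  have h0 : 0 ≤ A k := (norm_nonneg _).trans (hA k i x)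
  gcongr
  exacts [hA k i x, hB _ i x]

theorem add (hf : UniformlySmooth f) (hg : UniformlySmooth g) :
    UniformlySmooth fun i x ↦ f i x + g i x := by
  refine ⟨fun i ↦ (hf.contDiff i).add (hg.contDiff i), fun m ↦ ?_⟩
  obtain ⟨A, hA⟩ := hf.bounded m
  obtain ⟨B, hB⟩ := hg.bounded m
  refine ⟨A + B, fun i x ↦ ?_⟩
  rw [iteratedDeriv_fun_add (contDiffAt_nat (hf.contDiff i) m x)
    (contDiffAt_nat (hg.contDiff i) m x)]
  exact norm_add_le_of_le (hA i x) (hB i x)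

theorem const (c : ℂ) : UniformlySmooth fun (_ : ι) (_ : ℝ) ↦ c := by
  refine ⟨fun _ ↦ contDiff_const, fun m ↦ ⟨‖c‖, fun i x ↦ ?_⟩⟩
  rw [iteratedDeriv_const]
  split_ifs <;> simp

theorem deriv (hf : UniformlySmooth f) : UniformlySmooth fun i ↦ deriv (f i) := by
  refine ⟨fun i ↦ contDiff_deriv (hf.contDiff i), fun m ↦ ?_⟩
  obtain ⟨A, hA⟩ := hf.bounded (m + 1)
  refine ⟨A, fun i x ↦ ?_⟩
  rw [← iteratedDeriv_succ']
  exact hA i x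

theorem comp_const_sub (hf : UniformlySmooth f) (k : κ → ι) (c : κ → ℝ) :
    UniformlySmooth fun i x ↦ f (k i) (c i - x) := by
  refine ⟨fun i ↦ (hf.contDiff _).comp (contDiff_const.sub contDiff_id), fun m ↦ ?_⟩
  obtain ⟨A, hA⟩ := hf.bounded m
  refine ⟨A, fun i x ↦ ?_⟩
  rw [iteratedDeriv_comp_const_sub, norm_smul]
  simpa using hA (k i) (c i - x)

theorem comp_add_const (hf : UniformlySmooth f) (k : κ → ι) (c : κ → ℝ) :
    UniformlySmooth fun i x ↦ f (k i) (x + c i) := by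
  refine ⟨fun i ↦ (hf.contDiff _).comp (contDiff_id.add contDiff_const), fun m ↦ ?_⟩
  obtain ⟨A, hA⟩ := hf.bounded m
  refine ⟨A, fun i x ↦ ?_⟩
  rw [iteratedDeriv_comp_add_const]
  exact hA (k i) (x + c i)

end UniformlySmooth

/-- A smooth step: `0` on `(-∞, 0]` and `1` on `[1, ∞)`. -/
def step (x : ℝ) : ℂ := (Real.smoothTransition x : ℂ)

theorem step_of_nonpos {x : ℝ} (hx : x ≤ 0) : step x = 0 := by
  simp [step, Real.smoothTransition.zero_of_nonpos hx]

theorem step_of_one_le {x : ℝ} (hx : 1 ≤ x) : step x = 1 := by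
  simp [step, Real.smoothTransition.one_of_one_le hx]

theorem step_im (x : ℝ) : (step x).im = 0 := Complex.ofReal_im _

theorem contDiff_step : ContDiff ℝ ∞ step :=
  Complex.ofRealCLM.contDiff.comp Real.smoothTransition.contDiff

theorem uniformlySmooth_step : UniformlySmooth fun _ : Unit ↦ step := by
  refine ⟨fun _ ↦ contDiff_step, fun m ↦ ?_⟩
  have hcont : Continuous (iteratedDeriv m step) :=
    contDiff_step.continuous_iteratedDeriv m (by exact_mod_cast le_top)
  obtain ⟨C, hC⟩ := isCompact_Icc.exists_bound_of_continuousOn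
    (hcont.continuousOn (s := Icc (0 : ℝ) 1))
  have h1 : ∀ c : ℂ, ‖iteratedDeriv m (fun _ : ℝ ↦ c) 0‖ ≤ ‖c‖ := by
    intro c
    rw [iteratedDeriv_const]
    split_ifs <;> simp
  refine ⟨max C 1, fun _ x ↦ ?_⟩
  rcases lt_or_ge x 0 with hx | hx
  · have e : step =ᶠ[𝓝 x] fun _ ↦ 0 := by
      filter_upwards [Iio_mem_nhds hx] with y hy using step_of_nonpos (le_of_lt hy)
    rw [e.iteratedDeriv_eq, iteratedDeriv_const]
    simp
  rcases lt_or_ge 1 x with hx1 | hx1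
  · have e : step =ᶠ[𝓝 x] fun _ ↦ 1 := by
      filter_upwards [Ioi_mem_nhds hx1] with y hy using step_of_one_le (le_of_lt hy)
    rw [e.iteratedDeriv_eq, iteratedDeriv_const]
    split_ifs <;> simp
  · exact (hC x ⟨hx, hx1⟩).trans (le_max_left _ _)

/-! ### Estimates for tempered distributions -/

/-- Continuity of a tempered distribution in terms of finitely many Schwartz seminorms. -/
theorem exists_tempered_bound (T : 𝓢'(ℝ, ℂ)) : ∃ (n : ℕ) (C : ℝ), 0 ≤ C ∧
    ∀ (θ : 𝓢(ℝ, ℂ)) (B : ℝ), 0 ≤ B →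
      (∀ k ≤ n, ∀ j ≤ n, ∀ x : ℝ, |x| ^ k * ‖iteratedDeriv j θ x‖ ≤ B) → ‖T θ‖ ≤ C * B := by
  have hcont : Continuous fun θ : 𝓢(ℝ, ℂ) ↦ T θ := map_continuous T
  obtain ⟨s, C, -, hC⟩ := Seminorm.bound_of_continuous (schwartz_withSeminorms ℂ ℝ ℂ)
    ((normSeminorm ℂ ℂ).comp T.toLinearMap) (continuous_norm.comp hcont)
  refine ⟨s.sup Prod.fst + s.sup Prod.snd, C, C.2, fun θ B hB h ↦ ?_⟩
  refine (hC θ).trans ?_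
  change (C : ℝ) * _ ≤ _
  gcongr
  refine Seminorm.finset_sup_apply_le hB fun p hp ↦ ?_
  refine SchwartzMap.seminorm_le_bound' ℂ _ _ _ hB (h _ ?_ _ ?_)
  · exact (Finset.le_sup (f := Prod.fst) hp).trans (Nat.le_add_right _ _)
  · exact (Finset.le_sup (f := Prod.snd) hp).trans (Nat.le_add_left _ _)

theorem le_sum_range_sum {C : ℕ → ℕ → ℝ} (hC : ∀ k j, 0 ≤ C k j) {n k j : ℕ} (hk : k ≤ n)
    (hj : j ≤ n) : C k j ≤ ∑ k ∈ Finset.range (n + 1), ∑ j ∈ Finset.range (n + 1), C k j :=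
  (Finset.single_le_sum (f := fun j ↦ C k j) (fun j _ ↦ hC k j)
    (Finset.mem_range.2 (Nat.lt_succ_of_le hj))).trans
  (Finset.single_le_sum (f := fun k ↦ ∑ j ∈ Finset.range (n + 1), C k j)
    (fun k _ ↦ Finset.sum_nonneg fun j _ ↦ hC k j) (Finset.mem_range.2 (Nat.lt_succ_of_le hk)))

theorem exists_seminorm_mul_bound {ι : Type*} {f : ι → ℝ → ℂ} (hf : UniformlySmooth f)
    (θ : 𝓢(ℝ, ℂ)) (n : ℕ) : ∃ C : ℝ, 0 ≤ C ∧ ∀ i, ∀ k ≤ n, ∀ j ≤ n, ∀ x : ℝ,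
      |x| ^ k * ‖iteratedDeriv j (fun y ↦ f i y * θ y) x‖ ≤ C := by
  choose A hA using hf.bounded
  let D : ℕ → ℕ → ℝ := fun k j ↦ ∑ l ∈ Finset.range (j + 1),
    j.choose l * |A l| * SchwartzMap.seminorm ℂ k (j - l) θ
  have hD0 : ∀ k j, 0 ≤ D k j := fun k j ↦ Finset.sum_nonneg fun l _ ↦ by positivity
  refine ⟨∑ k ∈ Finset.range (n + 1), ∑ j ∈ Finset.range (n + 1), D k j,
    Finset.sum_nonneg fun k _ ↦ Finset.sum_nonneg fun j _ ↦ hD0 k j, fun i k hk j hj x ↦ ?_⟩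
  have h1 : |x| ^ k * ‖iteratedDeriv j (fun y ↦ f i y * θ y) x‖ ≤ D k j := by
    rw [iteratedDeriv_fun_mul (contDiffAt_nat (hf.contDiff i) j x)
      (contDiffAt_nat (θ.smooth ⊤) j x)]
    refine (mul_le_mul_of_nonneg_left (norm_sum_le _ _) (by positivity)).trans ?_
    rw [Finset.mul_sum]
    refine Finset.sum_le_sum fun l _ ↦ ?_
    rw [norm_mul, norm_mul, Complex.norm_natCast]
    calc |x| ^ k * (j.choose l * ‖iteratedDeriv l (f i) x‖ * ‖iteratedDeriv (j - l) θ x‖)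
        = j.choose l * ‖iteratedDeriv l (f i) x‖ * (|x| ^ k * ‖iteratedDeriv (j - l) θ x‖) := by
          ring
      _ ≤ j.choose l * |A l| * SchwartzMap.seminorm ℂ k (j - l) θ := by
          gcongr
          · exact (hA l i x).trans (le_abs_self _)
          · exact SchwartzMap.le_seminorm' ℂ k (j - l) θ x
  exact h1.trans (le_sum_range_sum hD0 hk hj)

theorem exists_tempered_mul_bound (T : 𝓢'(ℝ, ℂ)) {ι : Type*} {f : ι → ℝ → ℂ}
    (hf : UniformlySmooth f) (θ : 𝓢(ℝ, ℂ)) : ∃ C : ℝ, 0 ≤ C ∧ ∀ i, ∀ Θ : 𝓢(ℝ, ℂ),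
      (∀ x, Θ x = f i x * θ x) → ‖T Θ‖ ≤ C := by
  obtain ⟨n, C, hC0, hC⟩ := exists_tempered_bound T
  obtain ⟨D, hD0, hD⟩ := exists_seminorm_mul_bound hf θ n
  refine ⟨C * D, by positivity, fun i Θ hΘ ↦ hC Θ D hD0 fun k hk j hj x ↦ ?_⟩
  have e : (Θ : ℝ → ℂ) = fun y ↦ f i y * θ y := funext hΘ
  rw [e]
  exact hD i k hk j hj x

/-- If the products `f i * θ` with a uniformly smooth family vanish near the origin, a tempered
distribution is small on them: one additional power of `x` in the seminorms of `θ` pays for the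
factor `1 / r`. -/
theorem exists_tempered_tail_bound (T : 𝓢'(ℝ, ℂ)) {ι : Type*} {f : ι → ℝ → ℂ}
    (hf : UniformlySmooth f) (θ : 𝓢(ℝ, ℂ)) : ∃ C : ℝ, ∀ i, ∀ r > 0, ∀ Θ : 𝓢(ℝ, ℂ),
      (∀ x, Θ x = f i x * θ x) → (∀ x, |x| < r → Θ x = 0) → ‖T Θ‖ ≤ C / r := by
  obtain ⟨n, C, hC0, hC⟩ := exists_tempered_bound T
  obtain ⟨D, hD0, hD⟩ := exists_seminorm_mul_bound hf θ (n + 1)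
  refine ⟨C * D, fun i r hr Θ hΘ hz ↦ ?_⟩
  rw [mul_div_assoc]
  refine hC Θ (D / r) (by positivity) fun k hk j hj x ↦ ?_
  rcases lt_or_ge |x| r with hx | hx
  · have e : (Θ : ℝ → ℂ) =ᶠ[𝓝 x] fun _ ↦ 0 := by
      filter_upwards [(isOpen_lt continuous_abs continuous_const).mem_nhds hx] with y hy
      exact hz y hy
    rw [e.iteratedDeriv_eq, iteratedDeriv_const]
    simp only [ite_self, norm_zero, mul_zero]
    positivity
  · rw [le_div_iff₀ hr]
    have e : (Θ : ℝ → ℂ) = fun y ↦ f i y * θ y := funext hΘ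
    refine le_trans ?_ (hD i (k + 1) (by omega) j (by omega) x)
    rw [← e, pow_succ, mul_right_comm]
    gcongr

/-- If `f i → v` in the sense that `(f i - v) θ` vanishes on larger and larger intervals, then
`T (f i θ) → v T θ`. -/
theorem tendsto_tempered_mul (T : 𝓢'(ℝ, ℂ)) {f : ℕ → ℝ → ℂ} (hf : UniformlySmooth f)
    (θ : 𝓢(ℝ, ℂ)) (v : ℂ) (Θ : ℕ → 𝓢(ℝ, ℂ)) (hΘ : ∀ i x, Θ i x = f i x * θ x)
    (a : ℝ) (hv : ∀ (i : ℕ) (x : ℝ), |x| < i + a → Θ i x = v * θ x) :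
    Tendsto (fun i ↦ T (Θ i)) atTop (𝓝 (v * T θ)) := by
  obtain ⟨C, hC⟩ := exists_tempered_tail_bound T (hf.add (UniformlySmooth.const (-v))) θ
  rw [tendsto_iff_norm_sub_tendsto_zero]
  have hlim : Tendsto (fun i : ℕ ↦ (i : ℝ) + a) atTop atTop :=
    tendsto_natCast_atTop_atTop.atTop_add tendsto_const_nhds
  refine squeeze_zero' (Eventually.of_forall fun i ↦ norm_nonneg _) ?_ (hlim.const_div_atTop C)
  filter_upwards [hlim.eventually_gt_atTop 0] with i hi
  have e : T (Θ i) - v * T θ = T (Θ i - v • θ) := by simp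
  rw [e]
  refine hC i _ hi _ (fun x ↦ ?_) (fun x hx ↦ ?_)
  · simp only [sub_apply, smul_apply, hΘ, smul_eq_mul]
    ring
  · simp [hv i x hx]

/-! ### The exponential kernel -/

theorem contDiff_cexp_neg_mul (s : ℂ) : ContDiff ℝ ∞ fun x : ℝ ↦ Complex.exp (-(s * x)) :=
  (contDiff_const.mul Complex.ofRealCLM.contDiff).neg.cexp

theorem hasDerivAt_cexp_mul (s : ℂ) (x : ℝ) :
    HasDerivAt (fun x : ℝ ↦ Complex.exp (s * x)) (s * Complex.exp (s * x)) x := by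
  have h : HasDerivAt (fun x : ℝ ↦ s * (x : ℂ)) s x := by
    simpa using (Complex.ofRealCLM.hasDerivAt (x := x)).const_mul s
  simpa [mul_comm] using h.cexp

theorem iteratedDeriv_cexp_neg_mul (s : ℂ) (n : ℕ) (x : ℝ) :
    iteratedDeriv n (fun x : ℝ ↦ Complex.exp (-(s * x))) x
      = (-s) ^ n * Complex.exp (-(s * x)) := by
  induction n generalizing x with
  | zero => simp
  | succ n ih =>
    rw [iteratedDeriv_succ, funext ih]
    have h := (hasDerivAt_cexp_mul (-s) x).const_mul ((-s) ^ n)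
    simp only [neg_mul] at h
    rw [h.deriv]
    ring

/-- The function `ξ ↦ ρ(ξ) e^{-sξ}` for the fixed cut-off `ρ = step (· + 2)`, which is `1` on
`[-1, ∞)` and vanishes on `(-∞, -2]`. -/
def kernelFun (s : ℂ) (x : ℝ) : ℂ := step (x + 2) * Complex.exp (-(s * x))

theorem contDiff_step_add_two : ContDiff ℝ ∞ fun x : ℝ ↦ step (x + 2) :=
  contDiff_step.comp (contDiff_id.add contDiff_const)

theorem contDiff_kernelFun (s : ℂ) : ContDiff ℝ ∞ (kernelFun s) :=
  contDiff_step_add_two.mul (contDiff_cexp_neg_mul s)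

theorem iteratedDeriv_kernelFun (s : ℂ) (n : ℕ) (x : ℝ) :
    iteratedDeriv n (kernelFun s) x = ∑ i ∈ Finset.range (n + 1),
      n.choose i * iteratedDeriv i step (x + 2) * ((-s) ^ (n - i) * Complex.exp (-(s * x))) := by
  unfold kernelFun
  rw [iteratedDeriv_fun_mul (contDiffAt_nat contDiff_step_add_two n x)
    (contDiffAt_nat (contDiff_cexp_neg_mul s) n x)]
  refine Finset.sum_congr rfl fun i _ ↦ ?_
  rw [iteratedDeriv_cexp_neg_mul, iteratedDeriv_comp_add_const]

theorem norm_cexp_neg_mul (s : ℂ) (x : ℝ) :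
    ‖Complex.exp (-(s * x))‖ = Real.exp (-(s.re * x)) := by
  rw [Complex.norm_exp]
  simp

theorem pow_mul_exp_neg_le {a M σ x : ℝ} (ha : 0 < a) (haσ : a ≤ σ) (hσ : σ ≤ M) (hx : -2 ≤ x)
    (k : ℕ) : |x| ^ k * Real.exp (-(σ * x)) ≤ k.factorial / a ^ k + 2 ^ k * Real.exp (2 * M) := by
  rcases le_or_gt 0 x with h0 | h0
  · refine le_add_of_le_of_nonneg ?_ (by positivity)
    rw [le_div_iff₀ (by positivity), abs_of_nonneg h0, mul_right_comm, ← mul_pow, mul_comm x a,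
      Real.exp_neg, ← div_eq_mul_inv, div_le_iff₀ (Real.exp_pos _)]
    have h1 := Real.pow_div_factorial_le_exp (a * x) (by positivity) k
    rw [div_le_iff₀ (by positivity)] at h1
    refine h1.trans ?_
    rw [mul_comm]
    gcongr
  · refine le_add_of_nonneg_of_le (by positivity) ?_
    gcongr
    · rw [abs_of_neg h0]
      linarith
    · nlinarith

/-- The Schwartz seminorms of the kernel are bounded locally uniformly on the right half-plane. -/
theorem exists_kernelFun_bound {a : ℝ} (ha : 0 < a) (M : ℝ) (k n : ℕ) :
    ∃ C : ℝ, ∀ s : ℂ, a ≤ s.re → ‖s‖ ≤ M → ∀ x : ℝ,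
      |x| ^ k * ‖iteratedDeriv n (kernelFun s) x‖ ≤ C := by
  choose A hA using uniformlySmooth_step.bounded
  have hA : ∀ m x, ‖iteratedDeriv m step x‖ ≤ A m := fun m x ↦ hA m () x
  have hA0 : ∀ m, 0 ≤ A m := fun m ↦ (norm_nonneg _).trans (hA m 0)
  refine ⟨∑ i ∈ Finset.range (n + 1), n.choose i * A i *
    (|M| ^ (n - i) * (k.factorial / a ^ k + 2 ^ k * Real.exp (2 * M))), fun s hs hM x ↦ ?_⟩
  rcases lt_or_ge x (-2) with hx | hx
  · have e : kernelFun s =ᶠ[𝓝 x] fun _ ↦ 0 := by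
      filter_upwards [Iio_mem_nhds hx] with y hy
      rw [kernelFun, step_of_nonpos (by linarith [mem_Iio.1 hy]), zero_mul]
    rw [e.iteratedDeriv_eq, iteratedDeriv_const]
    simp only [ite_self, norm_zero, mul_zero]
    exact Finset.sum_nonneg fun i _ ↦ by have := hA0 i; positivity
  rw [iteratedDeriv_kernelFun]
  refine (mul_le_mul_of_nonneg_left (norm_sum_le _ _) (by positivity)).trans ?_
  rw [Finset.mul_sum]
  refine Finset.sum_le_sum fun i _ ↦ ?_
  rw [norm_mul, norm_mul, norm_mul, Complex.norm_natCast, norm_pow, norm_neg, norm_cexp_neg_mul]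
  calc |x| ^ k * (n.choose i * ‖iteratedDeriv i step (x + 2)‖ *
        (‖s‖ ^ (n - i) * Real.exp (-(s.re * x))))
      = n.choose i * ‖iteratedDeriv i step (x + 2)‖ *
        (‖s‖ ^ (n - i) * (|x| ^ k * Real.exp (-(s.re * x)))) := by ring
    _ ≤ _ := by
      have := hA0 i
      gcongr
      · exact hA i _
      · exact hM.trans (le_abs_self M)
      · exact pow_mul_exp_neg_le ha hs ((Complex.re_le_norm s).trans hM) hx k

/-- The kernel as a Schwartz function (`0` outside the right half-plane). -/
def kernel (s : ℂ) : 𝓢(ℝ, ℂ) :=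
  if hs : 0 < s.re then
    { toFun := kernelFun s
      smooth' := contDiff_kernelFun s
      decay' := fun k n ↦ by
        obtain ⟨C, hC⟩ := exists_kernelFun_bound hs ‖s‖ k n
        refine ⟨C, fun x ↦ ?_⟩
        rw [norm_iteratedFDeriv_eq_norm_iteratedDeriv]
        exact hC s le_rfl le_rfl x }
  else 0

theorem coe_kernel {s : ℂ} (hs : 0 < s.re) : (kernel s : ℝ → ℂ) = kernelFun s := by
  rw [kernel, dif_pos hs]
  rfl

/-! ### Holomorphic dependence on a parameter -/

/-- A bounded holomorphic function on a disc has difference quotients which converge at a rate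
depending only on the bound and the radius. This is the Schwarz lemma applied to `f` and to
`dslope f c`. -/
theorem norm_dslope_sub_le {f : ℂ → ℂ} {c : ℂ} {r M : ℝ} (hr : 0 < r)
    (hf : DifferentiableOn ℂ f (Metric.ball c r)) (hM : ∀ z ∈ Metric.ball c r, ‖f z‖ ≤ M)
    {z : ℂ} (hz : z ∈ Metric.ball c r) :
    ‖dslope f c z - dslope f c c‖ ≤ (4 * M) / r ^ 2 * ‖z - c‖ := by
  have hM0 : 0 ≤ M := (norm_nonneg _).trans (hM c (Metric.mem_ball_self hr))
  have hmaps : MapsTo f (Metric.ball c r) (Metric.closedBall (f c) (2 * M)) := by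
    intro w hw
    rw [mem_closedBall_iff_norm]
    refine (norm_sub_le _ _).trans ?_
    linarith [hM w hw, hM c (Metric.mem_ball_self hr)]
  have hd : DifferentiableOn ℂ (dslope f c) (Metric.ball c r) :=
    (Complex.differentiableOn_dslope (Metric.ball_mem_nhds c hr)).2 hf
  have hb : ∀ w ∈ Metric.ball c r, ‖dslope f c w‖ ≤ 2 * M / r := fun w hw ↦
    Complex.norm_dslope_le_div_of_mapsTo_ball hf hmaps hw
  have hmaps' : MapsTo (dslope f c) (Metric.ball c r)
      (Metric.closedBall (dslope f c c) ((4 * M) / r)) := by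
    intro w hw
    rw [mem_closedBall_iff_norm]
    refine (norm_sub_le _ _).trans ((add_le_add (hb w hw)
      (hb c (Metric.mem_ball_self hr))).trans ?_)
    rw [← add_div]
    exact div_le_div_of_nonneg_right (by linarith) hr.le
  have := Complex.dist_le_div_mul_dist_of_mapsTo_ball hd hmaps' hz
  rwa [dist_eq_norm, dist_eq_norm, div_div, ← sq] at this

/-- A tempered distribution applied to a family of Schwartz functions which depends pointwise
holomorphically on a parameter, with locally bounded seminorms, is holomorphic in the parameter. -/
theorem differentiableAt_tempered (T : 𝓢'(ℝ, ℂ)) (θ : ℂ → 𝓢(ℝ, ℂ)) {c : ℂ} {r : ℝ} (hr : 0 < r)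
    (hol : ∀ j x, DifferentiableOn ℂ (fun s ↦ iteratedDeriv j (θ s) x) (Metric.ball c r))
    (bdd : ∀ k j, ∃ C : ℝ, ∀ s ∈ Metric.ball c r, ∀ x, |x| ^ k * ‖iteratedDeriv j (θ s) x‖ ≤ C) :
    DifferentiableAt ℂ (fun s ↦ T (θ s)) c := by
  obtain ⟨n, A, hA0, hA⟩ := exists_tempered_bound T
  choose C hC using bdd
  have hC0 : ∀ k j, 0 ≤ C k j := fun k j ↦
    le_trans (by positivity) (hC k j c (Metric.mem_ball_self hr) 0)
  let D : ℝ := ∑ k ∈ Finset.range (n + 1), ∑ j ∈ Finset.range (n + 1), C k j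
  have hD : ∀ k ≤ n, ∀ j ≤ n, C k j ≤ D := fun k hk j hj ↦ le_sum_range_sum hC0 hk hj
  have hD0 : 0 ≤ D := Finset.sum_nonneg fun k _ ↦ Finset.sum_nonneg fun j _ ↦ hC0 k j
  let Q : ℂ → 𝓢(ℝ, ℂ) := fun z ↦ (z - c)⁻¹ • (θ z - θ c)
  have hQ : ∀ z, slope (fun s ↦ T (θ s)) c z = T (Q z) := fun z ↦ by
    simp [Q, slope_def_module]
  have hQd : ∀ z ≠ c, ∀ j x,
      iteratedDeriv j (Q z) x = dslope (fun s ↦ iteratedDeriv j (θ s) x) c z := by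
    intro z hz j x
    have e : (Q z : ℝ → ℂ) = (z - c)⁻¹ • ((θ z : ℝ → ℂ) - (θ c : ℝ → ℂ)) := rfl
    rw [e, dslope_of_ne _ hz, slope_def_module,
      iteratedDeriv_const_smul_field (z - c)⁻¹ ((θ z : ℝ → ℂ) - (θ c : ℝ → ℂ)),
      iteratedDeriv_sub (contDiffAt_nat ((θ z).smooth ⊤) j x)
        (contDiffAt_nat ((θ c).smooth ⊤) j x)]
  let K : ℝ := (4 * D) / r ^ 2
  have hK0 : 0 ≤ K := by positivity
  have key : ∀ z ∈ Metric.ball c r, z ≠ c → ∀ w ∈ Metric.ball c r, w ≠ c →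
      ‖T (Q z) - T (Q w)‖ ≤ A * (K * (‖z - c‖ + ‖w - c‖)) := by
    intro z hz hzc w hw hwc
    rw [← map_sub]
    refine hA _ _ (by positivity) fun k hk j hj x ↦ ?_
    have e : ((Q z - Q w : 𝓢(ℝ, ℂ)) : ℝ → ℂ) = (Q z : ℝ → ℂ) - (Q w : ℝ → ℂ) := rfl
    rw [e, iteratedDeriv_sub (contDiffAt_nat ((Q z).smooth ⊤) j x)
      (contDiffAt_nat ((Q w).smooth ⊤) j x), hQd z hzc, hQd w hwc]
    let f : ℂ → ℂ := fun s ↦ ((|x| : ℝ) : ℂ) ^ k * iteratedDeriv j (θ s) x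
    have hf : DifferentiableOn ℂ f (Metric.ball c r) := (hol j x).const_mul _
    have hfb : ∀ s ∈ Metric.ball c r, ‖f s‖ ≤ D := by
      intro s hs
      simp only [f, norm_mul, norm_pow, Complex.norm_real, Real.norm_eq_abs, abs_abs]
      exact (hC k j s hs x).trans (hD k hk j hj)
    have hds : ∀ s ≠ c, dslope f c s
        = ((|x| : ℝ) : ℂ) ^ k * dslope (fun s ↦ iteratedDeriv j (θ s) x) c s := by
      intro s hs
      rw [dslope_of_ne _ hs, dslope_of_ne _ hs, slope_def_field, slope_def_field]
      simp only [f]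
      ring
    have h1 := norm_dslope_sub_le hr hf hfb hz
    have h2 := norm_dslope_sub_le hr hf hfb hw
    calc |x| ^ k * ‖dslope (fun s ↦ iteratedDeriv j (θ s) x) c z
          - dslope (fun s ↦ iteratedDeriv j (θ s) x) c w‖
        = ‖(dslope f c z - dslope f c c) - (dslope f c w - dslope f c c)‖ := by
          rw [sub_sub_sub_cancel_right, hds z hzc, hds w hwc, ← mul_sub, norm_mul, norm_pow,
            Complex.norm_real, Real.norm_eq_abs, abs_abs]
      _ ≤ K * ‖z - c‖ + K * ‖w - c‖ := (norm_sub_le _ _).trans (add_le_add h1 h2)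
      _ = _ := by ring
  -- the derivative is found by completeness of `ℂ`, not computed in the Schwartz space
  have hcauchy : Cauchy (map (fun z ↦ T (Q z)) (𝓝[≠] c)) := by
    rw [Metric.cauchy_iff]
    refine ⟨inferInstance, fun ε hε ↦ ?_⟩
    let δ : ℝ := min r (ε / (2 * (A * K) + 1))
    have hδ : 0 < δ := lt_min hr (by positivity)
    refine ⟨(fun z ↦ T (Q z)) '' (Metric.ball c δ ∩ {c}ᶜ), image_mem_map
      (inter_mem (mem_nhdsWithin_of_mem_nhds (Metric.ball_mem_nhds c hδ)) self_mem_nhdsWithin), ?_⟩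
    rintro _ ⟨z, ⟨hz, hzc⟩, rfl⟩ _ ⟨w, ⟨hw, hwc⟩, rfl⟩
    have hsub : Metric.ball c δ ⊆ Metric.ball c r := Metric.ball_subset_ball (min_le_left _ _)
    rw [dist_eq_norm]
    refine (key z (hsub hz) hzc w (hsub hw) hwc).trans_lt ?_
    rw [mem_ball_iff_norm] at hz hw
    have hδ2 : δ * (2 * (A * K) + 1) ≤ ε := by
      rw [← le_div_iff₀ (by positivity)]
      exact min_le_right _ _
    have hAK : 0 ≤ A * K := by positivity
    nlinarith
  obtain ⟨l, hl⟩ := CompleteSpace.complete hcauchy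
  have hd : HasDerivAt (fun s ↦ T (θ s)) l c := by
    rw [hasDerivAt_iff_tendsto_slope, funext hQ]
    exact hl
  exact hd.differentiableAt

theorem differentiableOn_tempered_kernel (T : 𝓢'(ℝ, ℂ)) :
    DifferentiableOn ℂ (fun s ↦ T (kernel s)) {s : ℂ | 0 < s.re} := by
  intro c hc
  have hc : 0 < c.re := hc
  have hre : ∀ s ∈ Metric.ball c (c.re / 2), c.re / 2 ≤ s.re := by
    intro s hs
    rw [mem_ball_iff_norm] at hs
    have := (Complex.abs_re_le_norm (s - c)).trans hs.le
    rw [Complex.sub_re, abs_le] at this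
    linarith [this.1]
  refine (differentiableAt_tempered T kernel (r := c.re / 2) (by positivity) ?_ ?_)
    |>.differentiableWithinAt
  · intro j x
    refine DifferentiableOn.congr (f := fun s ↦ ∑ i ∈ Finset.range (j + 1),
      j.choose i * iteratedDeriv i step (x + 2) *
        ((-s) ^ (j - i) * Complex.exp (-(s * x)))) ?_ ?_
    · fun_prop
    · intro s hs
      rw [coe_kernel (by linarith [hre s hs]), iteratedDeriv_kernelFun]
  · intro k j
    obtain ⟨C, hC⟩ := exists_kernelFun_bound (half_pos hc) (‖c‖ + c.re / 2) k j
    refine ⟨C, fun s hs x ↦ ?_⟩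
    rw [coe_kernel (by linarith [hre s hs])]
    refine hC s (hre s hs) ?_ x
    rw [mem_ball_iff_norm] at hs
    linarith [norm_le_norm_add_norm_sub' s c]

/-! ### Supports -/

/-- A distribution vanishes on the test functions supported off its support, by a partition of
unity. -/
theorem apply_eq_zero_of_disjoint_supp (U : Distr ℝ) (φ : Test ℝ)
    (h : Disjoint (tsupport φ) (supp U)) : U φ = 0 := by
  have hcover : ∀ x : tsupport φ, ∃ a : Set ℝ, IsOpen a ∧ (x : ℝ) ∈ a ∧
      Distribution.IsVanishingOn (U : Test ℝ → ℂ) a := by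
    intro x
    have hx : (x : ℝ) ∈ (Distribution.dsupport (U : Test ℝ → ℂ))ᶜ :=
      fun hxs ↦ h.le_bot ⟨x.2, hxs⟩
    rw [Distribution.dsupport_compl_eq] at hx
    obtain ⟨a, ⟨hv, ho⟩, hxa⟩ := hx
    exact ⟨a, ho, hxa, hv⟩
  choose a ho hxa hv using hcover
  obtain ⟨f, hf⟩ := SmoothPartitionOfUnity.exists_isSubordinate (modelWithCornersSelf ℝ ℝ)
    (isClosed_tsupport φ) a ho (fun x hx ↦ mem_iUnion.2 ⟨⟨x, hx⟩, hxa ⟨x, hx⟩⟩)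
  have hfin : {i | (Function.support (f i) ∩ tsupport φ).Nonempty}.Finite :=
    f.locallyFinite.finite_nonempty_inter_compact φ.hasCompactSupport.isCompact
  let g : tsupport φ → Test ℝ := fun i ↦
    { toFun := fun x ↦ (f i x : ℂ) * φ x
      contDiff' := (Complex.ofRealCLM.contDiff.comp (f i).contMDiff.contDiff).mul φ.contDiff
      hasCompactSupport' := φ.hasCompactSupport.mul_left
      tsupport_subset' := fun _ _ ↦ trivial }
  have hg : ∀ i x, g i x = (f i x : ℂ) * φ x := fun _ _ ↦ rfl
  have hUg : ∀ i, U (g i) = 0 := by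
    intro i
    refine hv i (g i) (Subset.trans (closure_mono ?_) (hf i))
    intro x hx hx0
    exact hx (by rw [hg, hx0]; simp)
  have hsum : φ = ∑ i ∈ hfin.toFinset, g i := by
    ext x
    have e : (∑ i ∈ hfin.toFinset, g i) x = ∑ i ∈ hfin.toFinset, (f i x : ℂ) * φ x := by
      rw [sum_apply]
      exact Finset.sum_congr rfl fun i _ ↦ hg i x
    rw [e, ← Finset.sum_mul]
    by_cases hx : φ x = 0
    · simp [hx]
    have hxt : x ∈ tsupport φ := subset_tsupport _ hx
    have h1 : ∑ i ∈ hfin.toFinset, f i x = 1 := by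
      rw [← f.sum_eq_one hxt]
      refine (finsum_eq_sum_of_support_subset _ fun i hi ↦ ?_).symm
      simp only [Finite.coe_toFinset, mem_ofPred_eq]
      exact ⟨x, hi, hxt⟩
    rw [← Complex.ofReal_sum, h1]
    simp
  rw [hsum, map_sum]
  exact Finset.sum_eq_zero fun i _ ↦ hUg i

theorem apply_eq_of_eventuallyEq_supp (U : Distr ℝ) {φ ψ : Test ℝ}
    (h : (φ : ℝ → ℂ) =ᶠ[𝓝ˢ (supp U)] ψ) : U φ = U ψ := by
  rw [← sub_eq_zero, ← map_sub]
  refine apply_eq_zero_of_disjoint_supp U _ (disjoint_left.2 fun x hx hxs ↦ ?_)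
  refine notMem_tsupport_iff_eventuallyEq.2 ?_ hx
  filter_upwards [mem_nhdsSet_iff_forall.1 h x hxs] with y hy
  have hy : φ y = ψ y := hy
  simp [hy]

/-! ### Existence and uniqueness of the Laplace transform -/

/-- A smooth compactly supported function on the line as a test function. -/
def mkTest (f : ℝ → ℂ) (hf : ContDiff ℝ ∞ f) (hc : HasCompactSupport f) : Test ℝ where
  toFun := f
  contDiff' := hf
  hasCompactSupport' := hc
  tsupport_subset' := fun _ _ ↦ trivial

@[simp] theorem mkTest_apply (f : ℝ → ℂ) (hf hc) (x : ℝ) : mkTest f hf hc x = f x := rfl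

@[simp] theorem toSchwartz_apply (φ : Test ℝ) (x : ℝ) : toSchwartz φ x = φ x := rfl

/-- A smooth cut-off function which is `1` on `[1 - a, b - 1]` and vanishes off `[-a, b]`. -/
def plateau (a b x : ℝ) : ℂ := step (x + a) * step (b - x)

theorem uniformlySmooth_plateau {ι : Type*} (a b : ι → ℝ) :
    UniformlySmooth fun i ↦ plateau (a i) (b i) :=
  (uniformlySmooth_step.comp_add_const (fun _ ↦ ()) a).mul
    (uniformlySmooth_step.comp_const_sub (fun _ ↦ ()) b)

theorem contDiff_plateau (a b : ℝ) : ContDiff ℝ ∞ (plateau a b) :=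
  (uniformlySmooth_plateau (fun _ : Unit ↦ a) (fun _ ↦ b)).contDiff ()

theorem plateau_eq_one {a b x : ℝ} (h : 1 - a ≤ x) (h' : x ≤ b - 1) : plateau a b x = 1 := by
  rw [plateau, step_of_one_le (by linarith), step_of_one_le (by linarith), one_mul]

theorem hasCompactSupport_plateau (a b : ℝ) : HasCompactSupport (plateau a b) := by
  refine HasCompactSupport.intro (isCompact_Icc (a := -a) (b := b)) fun x hx ↦ ?_
  rw [plateau]
  by_cases h : -a ≤ x
  · rw [step_of_nonpos (x := b - x), mul_zero]
    by_contra hb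
    exact hx ⟨h, by linarith⟩
  · rw [step_of_nonpos (by linarith), zero_mul]

theorem plateau_im (a b x : ℝ) : (plateau a b x).im = 0 := by
  rw [plateau, Complex.mul_im, step_im, step_im]
  simp

/-- Truncation of a smooth function to a test function. -/
def truncate (a b : ℝ) (f : ℝ → ℂ) (hf : ContDiff ℝ ∞ f) : Test ℝ :=
  mkTest (fun x ↦ plateau a b x * f x) ((contDiff_plateau a b).mul hf)
    (hasCompactSupport_plateau a b).mul_right

@[simp] theorem truncate_apply (a b : ℝ) (f : ℝ → ℂ) (hf) (x : ℝ) :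
    truncate a b f hf x = plateau a b x * f x := rfl

theorem tendsto_tempered_truncate (T : 𝓢'(ℝ, ℂ)) (θ : 𝓢(ℝ, ℂ)) :
    Tendsto (fun n : ℕ ↦ T (toSchwartz (truncate (n + 1) (n + 1) θ (θ.smooth ⊤)))) atTop
      (𝓝 (T θ)) := by
  have h := tendsto_tempered_mul T
    (uniformlySmooth_plateau (fun n : ℕ ↦ (n + 1 : ℝ)) (fun n ↦ (n + 1 : ℝ))) θ 1
    (fun n ↦ toSchwartz (truncate (n + 1) (n + 1) θ (θ.smooth ⊤))) (fun _ _ ↦ rfl) 0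
    (fun n x hx ↦ by
      rw [add_zero, abs_lt] at hx
      rw [toSchwartz_apply, truncate_apply, plateau_eq_one (by linarith) (by linarith)])
  rwa [one_mul] at h

theorem expWeight_apply (c : ℝ) (U : Distr ℝ) (φ ψ : Test ℝ)
    (h : ∀ x : ℝ, ψ x = φ x * Complex.exp (-(c * x))) : expWeight c U φ = U ψ := by
  have e : ψ = (⟨fun x ↦ φ x * Complex.exp (-(c * x)),
      φ.contDiff.mul (contDiff_cexp_neg_mul c), φ.hasCompactSupport.mul_right,
      fun _ _ ↦ trivial⟩ : Test ℝ) := by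
    ext x
    exact h x
  rw [e]
  rfl

theorem eventually_step_eq_one {U : Distr ℝ} (hU : supp U ⊆ Ici 0) :
    ∀ᶠ x in 𝓝ˢ (supp U), step (x + 2) = 1 := by
  have : ∀ᶠ x in 𝓝ˢ (supp U), x ∈ Ioi (-1 : ℝ) := isOpen_Ioi.mem_nhdsSet.2 fun x hx ↦ by
    have : (0 : ℝ) ≤ x := hU hx
    exact mem_Ioi.2 (by linarith)
  filter_upwards [this] with x hx
  exact step_of_one_le (by linarith [mem_Ioi.1 hx])

/-- The Laplace transform of a tempered distribution supported in `[0, ∞)` exists on the right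
half-plane. All choices give the same value because on truncated kernels they reduce to values of
`U` on test functions which agree near the support of `U`. -/
theorem hasLaplaceAt_kernel {U : Distr ℝ} {T : 𝓢'(ℝ, ℂ)} (hT : Extends T U)
    (hU : supp U ⊆ Ici 0) {s : ℂ} (hs : 0 < s.re) : HasLaplaceAt U s (T (kernel s)) := by
  refine ⟨⟨0, hU⟩, ⟨0, T, fun x ↦ step (x + 2), kernel s, ?_⟩, ?_⟩
  · refine ⟨hs, fun φ ↦ ?_, contDiff_step_add_two, ⟨-2, fun x hx ↦ ?_⟩,
      eventually_step_eq_one hU, fun ξ ↦ ?_⟩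
    · rw [hT, expWeight_apply 0 U φ φ]
      simp
    · by_contra h
      exact hx (step_of_nonpos (by linarith))
    · rw [coe_kernel hs]
      simp [kernelFun]
  · intro c T' ρ θ hd
    refine tendsto_nhds_unique (tendsto_tempered_truncate T' θ) ?_
    refine (tendsto_tempered_truncate T (kernel s)).congr fun n ↦ ?_
    rw [hT, hd.tempered, expWeight_apply c U _ (truncate (n + 1) (n + 1)
      (fun x ↦ θ x * Complex.exp (-(c * x))) ((θ.smooth ⊤).mul (contDiff_cexp_neg_mul c)))
      (fun x ↦ by simp only [truncate_apply, mul_assoc])]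
    refine apply_eq_of_eventuallyEq_supp U ?_
    filter_upwards [hd.eq_one, eventually_step_eq_one hU] with x h1 h2
    rw [truncate_apply, truncate_apply, hd.eq_mul, coe_kernel hs, kernelFun, h1, h2, one_mul,
      one_mul, ← Complex.exp_add]
    congr 2
    ring

/-! ### Convolution with test functions -/

/-- The test function `t ↦ φ(x - t)`. -/
def reflect (φ : Test ℝ) (x : ℝ) : Test ℝ :=
  mkTest (fun t ↦ φ (x - t)) (φ.contDiff.comp (contDiff_const.sub contDiff_id))
    (φ.hasCompactSupport.comp_homeomorph (Homeomorph.subLeft x))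

@[simp] theorem reflect_apply (φ : Test ℝ) (x t : ℝ) : reflect φ x t = φ (x - t) := rfl

/-- The convolution of a distribution and a test function as a function,
`x ↦ ⟨Y, t ↦ φ(x - t)⟩`. -/
def conv (Y : Distr ℝ) (φ : Test ℝ) (x : ℝ) : ℂ := Y (reflect φ x)

/-- The derivative of a test function on the line. -/
def derivTest (φ : Test ℝ) : Test ℝ :=
  mkTest (deriv φ) (contDiff_deriv φ.contDiff) φ.hasCompactSupport.deriv

@[simp] theorem derivTest_apply (φ : Test ℝ) (x : ℝ) : derivTest φ x = deriv φ x := rfl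

theorem iteratedDeriv_eq_derivTest (φ : Test ℝ) (j : ℕ) :
    iteratedDeriv j φ = (derivTest^[j] φ : Test ℝ) := by
  induction j generalizing φ with
  | zero => simp
  | succ j ih =>
    rw [iteratedDeriv_succ', Function.iterate_succ_apply, ← ih]
    rfl

theorem hasDerivAt_conv (Y : Distr ℝ) (φ : Test ℝ) (x : ℝ) :
    HasDerivAt (conv Y φ) (conv Y (derivTest φ) x) x := by
  -- the cut-off `κ` makes `(t₁, t₂) ↦ φ(t₁ - t₂)` compactly supported without changing it near
  -- `t₁ = x`
  let κ : ℝ → ℂ := plateau (2 - x) (x + 2)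
  have hκ : κ =ᶠ[𝓝 x] fun _ ↦ 1 := by
    filter_upwards [Ioo_mem_nhds (show x - 1 < x by linarith) (show x < x + 1 by linarith)] with y hy
    exact plateau_eq_one (by linarith [hy.1]) (by linarith [hy.2])
  let Ψ : Test (ℝ × ℝ) :=
    { toFun := fun z ↦ κ z.1 * φ (z.1 - z.2)
      contDiff' := ((contDiff_plateau _ _).comp contDiff_fst).mul
        (φ.contDiff.comp (contDiff_fst.sub contDiff_snd))
      hasCompactSupport' := by
        have hK : IsCompact ((fun z : ℝ × ℝ ↦ (z.1, z.1 - z.2)) '' (tsupport κ ×ˢ tsupport φ)) :=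
          ((hasCompactSupport_plateau _ _).isCompact.prod φ.hasCompactSupport.isCompact).image
            (by fun_prop)
        refine HasCompactSupport.intro hK fun z hz ↦ ?_
        by_contra h
        refine hz ⟨(z.1, z.1 - z.2), ⟨subset_tsupport _ (left_ne_zero_of_mul h),
          subset_tsupport _ (right_ne_zero_of_mul h)⟩, ?_⟩
        ext <;> simp
      tsupport_subset' := fun _ _ ↦ trivial }
  have hΨ : ∀ u v, Ψ (u, v) = κ u * φ (u - v) := fun _ _ ↦ rfl
  have h := hasDerivAt_pairing Y Ψ x
  have e1 : slice (pd (1, 0) Ψ) x = reflect (derivTest φ) x := by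
    ext t
    rw [slice_apply, reflect_apply, derivTest_apply]
    refine (hasDerivAt_fst Ψ x t).unique ?_
    have h1 : HasDerivAt (fun u ↦ φ (u - t)) (deriv φ (x - t)) x :=
      HasDerivAt.comp_sub_const x t
        ((φ.contDiff.differentiable (by simp) (x - t)).hasDerivAt)
    refine h1.congr_of_eventuallyEq ?_
    filter_upwards [hκ] with u hu
    rw [hΨ, hu, one_mul]
  rw [e1] at h
  refine h.congr_of_eventuallyEq ?_
  filter_upwards [hκ] with u hu
  rw [conv]
  congr 1
  ext t
  rw [slice_apply, reflect_apply, hΨ, hu, one_mul]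

theorem continuous_conv (Y : Distr ℝ) (φ : Test ℝ) : Continuous (conv Y φ) :=
  continuous_iff_continuousAt.2 fun x ↦ (hasDerivAt_conv Y φ x).continuousAt

theorem iteratedDeriv_conv (Y : Distr ℝ) (φ : Test ℝ) (j : ℕ) :
    iteratedDeriv j (conv Y φ) = conv Y (derivTest^[j] φ) := by
  induction j generalizing φ with
  | zero => simp
  | succ j ih =>
    rw [iteratedDeriv_succ', Function.iterate_succ_apply, ← ih]
    congr 1
    ext x
    exact (hasDerivAt_conv Y φ x).deriv

theorem exists_isUnitSequence : ∃ η : ℕ → Test (ℝ × ℝ), IsUnitSequence η := by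
  let b : ContDiffBump (0 : ℝ × ℝ) := ⟨1, 2, one_pos, one_lt_two⟩
  let B : ℝ × ℝ → ℂ := fun z ↦ (b z : ℂ)
  have hB : ContDiff ℝ ∞ B := Complex.ofRealCLM.contDiff.comp b.contDiff
  have hBc : HasCompactSupport B := b.hasCompactSupport.comp_left Complex.ofReal_zero
  let L : ℕ → (ℝ × ℝ) →L[ℝ] (ℝ × ℝ) := fun k ↦ ((k + 1 : ℝ)⁻¹) • ContinuousLinearMap.id ℝ (ℝ × ℝ)
  have hLapp : ∀ k z, L k z = (k + 1 : ℝ)⁻¹ • z := fun _ _ ↦ rfl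
  have hL : ∀ k, ‖L k‖ ≤ 1 := by
    intro k
    refine ContinuousLinearMap.opNorm_le_bound _ zero_le_one fun z ↦ ?_
    rw [hLapp, norm_smul, Real.norm_of_nonneg (by positivity)]
    gcongr
    exact inv_le_one_of_one_le₀ (by linarith [k.cast_nonneg (α := ℝ)])
  refine ⟨fun k ↦
    { toFun := fun z ↦ B (L k z)
      contDiff' := hB.comp (L k).contDiff
      hasCompactSupport' := hBc.comp_homeomorph
        (Homeomorph.smulOfNeZero (k + 1 : ℝ)⁻¹ (by positivity))
      tsupport_subset' := fun _ _ ↦ trivial }, ⟨fun K hK ↦ ?_, fun m ↦ ?_⟩⟩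
  · obtain ⟨R, hR⟩ := hK.isBounded.exists_norm_le
    have hlim : Tendsto (fun k : ℕ ↦ (k : ℝ) + 1) atTop atTop :=
      tendsto_natCast_atTop_atTop.atTop_add tendsto_const_nhds
    filter_upwards [hlim.eventually_ge_atTop R] with k hk z hz
    change ((b (L k z) : ℝ) : ℂ) = 1
    rw [b.one_of_mem_closedBall, Complex.ofReal_one]
    rw [mem_closedBall_zero_iff, hLapp, norm_smul, Real.norm_of_nonneg (by positivity),
      inv_mul_le_iff₀ (by positivity)]
    change _ ≤ ((k : ℝ) + 1) * 1
    linarith [hR z hz]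
  · have hcont : Continuous (iteratedFDeriv ℝ m B) :=
      hB.continuous_iteratedFDeriv (by exact_mod_cast le_top)
    obtain ⟨C, hC⟩ := hcont.bounded_above_of_compact_support (hBc.iteratedFDeriv m)
    refine ⟨C, fun k z ↦ ?_⟩
    change ‖iteratedFDeriv ℝ m (B ∘ L k) z‖ ≤ C
    rw [(L k).iteratedFDeriv_comp_right hB z (by exact_mod_cast le_top)]
    refine (ContinuousMultilinearMap.norm_compContinuousLinearMap_le _ _).trans ?_
    refine (mul_le_of_le_one_right (norm_nonneg _) ?_).trans (hC _)
    exact Finset.prod_le_one (fun _ _ ↦ norm_nonneg _) fun _ _ ↦ hL k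

/-- A normed bump function as a test function. -/
def bumpTest (b : ContDiffBump (0 : ℝ)) : Test ℝ :=
  mkTest (fun x ↦ (b.normed volume x : ℂ)) (Complex.ofRealCLM.contDiff.comp b.contDiff_normed)
    (b.hasCompactSupport_normed.comp_left Complex.ofReal_zero)

/-- The mollification `b ⋆ φ` of a test function. -/
def mollify (b : ContDiffBump (0 : ℝ)) (φ : Test ℝ) : Test ℝ :=
  mkTest (convolution (b.normed volume) φ (ContinuousLinearMap.lsmul ℝ ℝ) volume)
    (φ.hasCompactSupport.contDiff_convolution_right (n := ⊤) _
      b.continuous_normed.locallyIntegrable φ.contDiff)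
    (b.hasCompactSupport_normed.convolution _ φ.hasCompactSupport)

theorem mollify_eq (b : ContDiffBump (0 : ℝ)) (φ : Test ℝ) : (mollify b φ : ℝ → ℂ)
    = convolution (b.normed volume) φ (ContinuousLinearMap.lsmul ℝ ℝ) volume := rfl

theorem derivTest_mollify (b : ContDiffBump (0 : ℝ)) (φ : Test ℝ) :
    derivTest (mollify b φ) = mollify b (derivTest φ) := by
  ext x
  exact (φ.hasCompactSupport.hasDerivAt_convolution_right _
    b.continuous_normed.locallyIntegrable (φ.contDiff.of_le (by exact_mod_cast le_top)) x).deriv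

theorem derivTest_iterate_mollify (b : ContDiffBump (0 : ℝ)) (φ : Test ℝ) (j : ℕ) :
    derivTest^[j] (mollify b φ) = mollify b (derivTest^[j] φ) :=
  (Function.Commute.iterate_left (g := mollify b) (fun φ ↦ derivTest_mollify b φ) j) φ

/-- The value of `Y * φ` on a reflected bump function: for large `k` the cut-off `η k` is `1` on the
relevant compact set, and the direct product reduces to `Y` applied to a mollification of `φ`. -/
theorem IsConvolution.apply_reflect_bumpTest {Y Z : Distr ℝ} {φ : Test ℝ}
    (h : IsConvolution Y (regular φ) Z) (b : ContDiffBump (0 : ℝ)) (x : ℝ) :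
    Z (reflect (bumpTest b) x) = conv Y (mollify b φ) x := by
  obtain ⟨η, hη⟩ := exists_isUnitSequence
  let f : Test ℝ := reflect (bumpTest b) x
  refine tendsto_nhds_unique (h η hη f) (tendsto_const_nhds.congr' ?_)
  have hK : IsCompact ((fun z : ℝ × ℝ ↦ (z.1 - z.2, z.2)) '' (tsupport f ×ˢ tsupport φ)) :=
    (f.hasCompactSupport.isCompact.prod φ.hasCompactSupport.isCompact).image (by fun_prop)
  filter_upwards [hη.eventually_one _ hK] with k hk
  rw [directProduct, conv]
  congr 1
  ext t
  change mollify b φ (x - t) = regular φ (slice (cutSum (η k) f) t)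
  rw [regular_apply φ.continuous.locallyIntegrable, mollify_eq, convolution_eq_swap]
  refine integral_congr_ae (Eventually.of_forall fun u ↦ ?_)
  have e : slice (cutSum (η k) f) t u = η k (t, u) * f (t + u) := rfl
  have e2 : f (t + u) = (b.normed volume (x - t - u) : ℂ) := by
    rw [sub_sub]
    rfl
  simp only [ContinuousLinearMap.lsmul_apply, Complex.real_smul]
  rw [e, ← e2]
  by_cases hu : φ u = 0
  · simp [hu]
  by_cases hv : f (t + u) = 0
  · simp [hv]
  rw [hk (t, u) ⟨(t + u, u), ⟨subset_tsupport _ hv, subset_tsupport _ hu⟩, by simp⟩, one_mul]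

/-! ### Mollification -/

/-- The weight `|x - y| ^ k` does no harm, as the increment vanishes for `y` away from the support
of `φ`. -/
theorem exists_weighted_lipschitz (φ : Test ℝ) (x : ℝ) (k : ℕ) : ∃ C : ℝ, 0 ≤ C ∧
    ∀ y y' : ℝ, |y' - y| ≤ 1 → |x - y| ^ k * ‖φ y' - φ y‖ ≤ C * |y' - y| := by
  obtain ⟨M, hM⟩ := (contDiff_deriv φ.contDiff).continuous.bounded_above_of_compact_support
    φ.hasCompactSupport.deriv
  have hM0 : 0 ≤ M := (norm_nonneg _).trans (hM 0)
  obtain ⟨R, hR⟩ := φ.hasCompactSupport.isCompact.isBounded.exists_norm_le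
  have hzero : ∀ y : ℝ, R < |y| → φ y = 0 := fun y hy ↦
    image_eq_zero_of_notMem_tsupport fun h ↦ absurd (hR y h) (not_le.2 hy)
  refine ⟨|(|x| + (R + 1))| ^ k * M, by positivity, fun y y' hyy ↦ ?_⟩
  have hlip : ‖φ y' - φ y‖ ≤ M * |y' - y| := by
    simpa using convex_univ.norm_image_sub_le_of_norm_deriv_le
      (fun z _ ↦ φ.contDiff.differentiable (by simp) z) (fun z _ ↦ hM z) (mem_univ y) (mem_univ y')
  rcases le_or_gt |y| (R + 1) with hy | hy
  · rw [mul_assoc]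
    have h1 : |x - y| ≤ |x| + |y| := norm_sub_le x y
    have h2 : |x - y| ≤ |(|x| + (R + 1))| := (h1.trans (by linarith)).trans (le_abs_self _)
    exact mul_le_mul (pow_le_pow_left₀ (abs_nonneg _) h2 k) hlip (norm_nonneg _) (by positivity)
  · have h1 : |y| ≤ |y'| + |y' - y| := by
      have : |y' - (y' - y)| ≤ |y'| + |y' - y| := norm_sub_le y' (y' - y)
      rwa [sub_sub_cancel] at this
    rw [hzero y (by linarith), hzero y' (by linarith), sub_zero, norm_zero, mul_zero]
    positivity

/-- The reflected mollifications converge to the reflection of `φ` in every Schwartz seminorm: the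
derivatives are the mollifications of those of `φ`, which are Lipschitz. -/
theorem tendsto_conv_mollify {Y : Distr ℝ} {T : 𝓢'(ℝ, ℂ)} (hT : Extends T Y) (φ : Test ℝ) (x : ℝ)
    {b : ℕ → ContDiffBump (0 : ℝ)} (hb : Tendsto (fun i ↦ (b i).rOut) atTop (𝓝 0)) :
    Tendsto (fun i ↦ conv Y (mollify (b i) φ) x) atTop (𝓝 (conv Y φ x)) := by
  obtain ⟨n, A, hA0, hA⟩ := exists_tempered_bound T
  choose C hC0 hC using fun k j ↦ exists_weighted_lipschitz (derivTest^[j] φ) x k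
  let D : ℝ := ∑ k ∈ Finset.range (n + 1), ∑ j ∈ Finset.range (n + 1), C k j
  have hD : ∀ k ≤ n, ∀ j ≤ n, C k j ≤ D := fun k hk j hj ↦ le_sum_range_sum hC0 hk hj
  have hD0 : 0 ≤ D := Finset.sum_nonneg fun k _ ↦ Finset.sum_nonneg fun j _ ↦ hC0 k j
  rw [tendsto_iff_norm_sub_tendsto_zero]
  have hlim : Tendsto (fun i ↦ A * (D * (b i).rOut)) atTop (𝓝 0) := by
    simpa using (hb.const_mul D).const_mul A
  refine squeeze_zero' (Eventually.of_forall fun i ↦ norm_nonneg _) ?_ hlim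
  filter_upwards [hb.eventually_le_const one_pos] with i hi
  have hr := (b i).rOut_pos
  rw [conv, conv, ← hT, ← hT, ← map_sub]
  refine hA _ _ (by positivity) fun k hk j hj t ↦ ?_
  have href : ∀ ψ : Test ℝ, iteratedDeriv j (toSchwartz (reflect ψ x)) t
      = (-1 : ℝ) ^ j • (derivTest^[j] ψ) (x - t) := by
    intro ψ
    have e : (toSchwartz (reflect ψ x) : ℝ → ℂ) = fun t ↦ ψ (x - t) := rfl
    rw [e, iteratedDeriv_comp_const_sub, iteratedDeriv_eq_derivTest]
  have e : ((toSchwartz (reflect (mollify (b i) φ) x) - toSchwartz (reflect φ x) : 𝓢(ℝ, ℂ)) : ℝ → ℂ)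
    = (toSchwartz (reflect (mollify (b i) φ) x) : ℝ → ℂ) - (toSchwartz (reflect φ x) : ℝ → ℂ) := rfl
  rw [e, iteratedDeriv_sub (contDiffAt_nat (SchwartzMap.smooth _ ⊤) j t)
    (contDiffAt_nat (SchwartzMap.smooth _ ⊤) j t), href, href, ← smul_sub, norm_smul, norm_pow,
    norm_neg, norm_one, one_pow, one_mul, derivTest_iterate_mollify, mollify_eq]
  rcases (pow_nonneg (abs_nonneg t) k).eq_or_lt with h0 | h0
  · rw [← h0, zero_mul]
    positivity
  · rw [← le_div_iff₀' h0, ← dist_eq_norm]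
    refine (b i).dist_normed_convolution_le (derivTest^[j] φ).continuous.aestronglyMeasurable
      fun y hy ↦ ?_
    rw [mem_ball_iff_norm, Real.norm_eq_abs] at hy
    rw [le_div_iff₀' h0, dist_eq_norm]
    have := hC k j (x - t) y (hy.le.trans hi)
    rw [sub_sub_cancel] at this
    refine this.trans ?_
    have := hD k hk j hj
    gcongr

/-- Bump functions shrinking to the origin, with a fixed ratio of the radii. -/
def shrinkingBump (i : ℕ) : ContDiffBump (0 : ℝ) where
  rIn := 1 / (i + 1)
  rOut := 2 * (1 / (i + 1))
  rIn_pos := by positivity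
  rIn_lt_rOut := by
    have : (0 : ℝ) < 1 / (i + 1) := by positivity
    linarith

theorem tendsto_shrinkingBump_rOut : Tendsto (fun i ↦ (shrinkingBump i).rOut) atTop (𝓝 0) := by
  have h := (tendsto_one_div_add_atTop_nhds_zero_nat (𝕜 := ℝ)).const_mul 2
  rw [mul_zero] at h
  exact h

theorem IsConvolution.tendsto_conv {Y Z : Distr ℝ} {T : 𝓢'(ℝ, ℂ)} (hT : Extends T Y) {φ : Test ℝ}
    (h : IsConvolution Y (regular φ) Z) (x : ℝ) :
    Tendsto (fun i ↦ Z (reflect (bumpTest (shrinkingBump i)) x)) atTop (𝓝 (conv Y φ x)) := by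
  simp_rw [h.apply_reflect_bumpTest]
  exact tendsto_conv_mollify hT φ x tendsto_shrinkingBump_rOut

/-- If `Y * φ` is a regular distribution, its density is the pointwise convolution. -/
theorem IsConvolution.ae_eq_conv {Y : Distr ℝ} {T : 𝓢'(ℝ, ℂ)} (hT : Extends T Y) {φ : Test ℝ}
    {ψ : ℝ → ℂ} (hψ : LocallyIntegrable ψ volume) (h : IsConvolution Y (regular φ) (regular ψ)) :
    ψ =ᵐ[volume] conv Y φ := by
  filter_upwards [ContDiffBump.ae_convolution_tendsto_right_of_locallyIntegrable (K := 2)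
    tendsto_shrinkingBump_rOut (Eventually.of_forall fun i ↦ le_rfl) hψ] with x hx
  refine tendsto_nhds_unique hx ((h.tendsto_conv hT x).congr fun i ↦ ?_)
  rw [regular_apply hψ, convolution_eq_swap]
  rfl

theorem IsConvolution.conv_im_eq_zero {Y Z : Distr ℝ} {T : 𝓢'(ℝ, ℂ)} (hT : Extends T Y)
    {φ : Test ℝ} (h : IsConvolution Y (regular φ) Z) (hZ : IsReal Z) (x : ℝ) :
    (conv Y φ x).im = 0 := by
  refine tendsto_nhds_unique ((Complex.continuous_im.tendsto _).comp (h.tendsto_conv hT x))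
    (tendsto_const_nhds.congr fun i ↦ ?_)
  exact (hZ _ fun t ↦ Complex.ofReal_im _).symm

/-- Pseudo-passivity in terms of the smooth function `conv Y φ`. -/
theorem IsPseudoPassive.conv_inequality {Y : Distr ℝ} {T : 𝓢'(ℝ, ℂ)} (hT : Extends T Y) {N : ℕ}
    {c d : Fin (N + 1) → ℝ} (hY : IsPseudoPassive Y N c d) (φ : Test ℝ) (t : ℝ) :
    ∑ j : Fin (N + 1), ∫ τ in Iic t, (c j * ‖(derivTest^[j] φ) τ‖ ^ 2
        + d j * ‖conv Y (derivTest^[j] φ) τ‖ ^ 2)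
      ≤ (∫ τ in Iic t, starRingEnd ℂ (φ τ) * conv Y φ τ).re := by
  obtain ⟨ψ, hψ, hconv, htest, hineq⟩ := hY φ
  have hae := hconv.ae_eq_conv hT hψ
  have hright : ∫ τ in Iic t, starRingEnd ℂ (φ τ) * ψ τ
      = ∫ τ in Iic t, starRingEnd ℂ (φ τ) * conv Y φ τ :=
    integral_congr_ae (ae_restrict_of_ae (hae.mono fun τ hτ ↦ by simp only [hτ]))
  rw [← hright]
  refine le_trans (le_of_eq (Finset.sum_congr rfl fun j _ ↦ ?_)) (hineq t)
  rw [iteratedDeriv_eq_derivTest]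
  -- for `d = 0` the function `ψ` is only known almost everywhere, but its derivatives are not used
  by_cases hd : d = 0
  · simp [hd]
  · obtain ⟨χ, rfl⟩ := htest hd
    rw [(Continuous.ae_eq_iff_eq volume χ.continuous (continuous_conv Y φ)).1 hae,
      iteratedDeriv_conv]

/-! ### Testing with truncated exponentials -/

/-- The test function `τ ↦ b(τ) e^{sτ}`. -/
def expMul (s : ℂ) (b : Test ℝ) : Test ℝ :=
  mkTest (fun x ↦ b x * Complex.exp (s * x))
    (b.contDiff.mul (contDiff_const.mul Complex.ofRealCLM.contDiff).cexp)
    b.hasCompactSupport.mul_right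

@[simp] theorem expMul_apply (s : ℂ) (b : Test ℝ) (x : ℝ) :
    expMul s b x = b x * Complex.exp (s * x) := rfl

theorem derivTest_expMul (s : ℂ) (b : Test ℝ) :
    derivTest (expMul s b) = expMul s (derivTest b + s • b) := by
  ext x
  have h := ((b.contDiff.differentiable (by simp) x).hasDerivAt).mul (hasDerivAt_cexp_mul s x)
  refine h.deriv.trans ?_
  simp only [expMul_apply, add_apply, smul_apply, derivTest_apply, smul_eq_mul]
  ring

/-- A uniformly smooth sequence of test functions equal to the constant `v` on intervals which
exhaust `(-∞, 2)`. -/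
structure IsPlateauSequence (b : ℕ → Test ℝ) (v : ℂ) : Prop where
  uniformlySmooth : UniformlySmooth fun n ↦ (b n : ℝ → ℂ)
  eq_const : ∀ (n : ℕ) (x : ℝ), -n < x → x < 2 → b n x = v

theorem IsPlateauSequence.derivTest_add_smul {b : ℕ → Test ℝ} {v : ℂ} (hb : IsPlateauSequence b v)
    (s : ℂ) : IsPlateauSequence (fun n ↦ derivTest (b n) + s • b n) (s * v) := by
  refine ⟨hb.uniformlySmooth.deriv.add ((UniformlySmooth.const s).mul hb.uniformlySmooth),
    fun n x hx hx2 ↦ ?_⟩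
  have e : (b n : ℝ → ℂ) =ᶠ[𝓝 x] fun _ ↦ v := by
    filter_upwards [Ioo_mem_nhds hx hx2] with y hy using hb.eq_const n y hy.1 hy.2
  simp [e.deriv_eq, hb.eq_const n x hx hx2]

theorem IsPlateauSequence.iterate {b : ℕ → Test ℝ} {v : ℂ} (hb : IsPlateauSequence b v)
    (s : ℂ) (j : ℕ) : ∃ b' : ℕ → Test ℝ, IsPlateauSequence b' (s ^ j * v) ∧
      ∀ n, derivTest^[j] (expMul s (b n)) = expMul s (b' n) := by
  induction j with
  | zero => exact ⟨b, by simpa using hb, fun _ ↦ rfl⟩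
  | succ j ih =>
    obtain ⟨b', hb', h⟩ := ih
    refine ⟨_, by simpa only [pow_succ', mul_assoc] using hb'.derivTest_add_smul s, fun n ↦ ?_⟩
    rw [Function.iterate_succ_apply', h, derivTest_expMul]

/-- The truncations `1` on `[-n, 2]` and `0` off `[-n - 1, 3]` of the constant `1`. -/
def plateauTest (n : ℕ) : Test ℝ :=
  mkTest (plateau (n + 1) 3) (contDiff_plateau _ _) (hasCompactSupport_plateau _ _)

theorem isPlateauSequence_plateauTest : IsPlateauSequence plateauTest 1 :=
  ⟨uniformlySmooth_plateau (fun n : ℕ ↦ (n + 1 : ℝ)) (fun _ ↦ 3), fun n x hx hx2 ↦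
    plateau_eq_one (by linarith) (by linarith)⟩

/-- The test function `ξ ↦ b(x - ξ) ρ(ξ) e^{-sξ}`. -/
def kernelMul (s : ℂ) (b : Test ℝ) (x : ℝ) : Test ℝ :=
  mkTest (fun ξ ↦ b (x - ξ) * kernelFun s ξ)
    ((reflect b x).contDiff.mul (contDiff_kernelFun s)) (reflect b x).hasCompactSupport.mul_right

theorem conv_expMul {Y : Distr ℝ} {T : 𝓢'(ℝ, ℂ)} (hT : Extends T Y) (hY : supp Y ⊆ Ici 0)
    (s : ℂ) (b : Test ℝ) (x : ℝ) :
    conv Y (expMul s b) x = Complex.exp (s * x) * T (toSchwartz (kernelMul s b x)) := by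
  rw [hT, conv, ← smul_eq_mul, ← map_smul]
  refine apply_eq_of_eventuallyEq_supp Y ?_
  filter_upwards [eventually_step_eq_one hY] with ξ hξ
  have e : (Complex.exp (s * x) • kernelMul s b x) ξ
    = Complex.exp (s * x) * (b (x - ξ) * (step (ξ + 2) * Complex.exp (-(s * ξ)))) := rfl
  rw [e, hξ, reflect_apply, expMul_apply, one_mul, mul_left_comm, ← Complex.exp_add]
  congr 3
  push_cast
  ring

theorem norm_cexp_mul (s : ℂ) (x : ℝ) : ‖Complex.exp (s * x)‖ = Real.exp (s.re * x) := by
  rw [Complex.norm_exp]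
  simp

namespace IsPlateauSequence

variable {b : ℕ → Test ℝ} {v : ℂ}

theorem exists_norm_expMul_le (hb : IsPlateauSequence b v) (s : ℂ) :
    ∃ C : ℝ, ∀ n x, ‖expMul s (b n) x‖ ≤ C * Real.exp (s.re * x) := by
  obtain ⟨C, hC⟩ := hb.uniformlySmooth.bounded 0
  refine ⟨C, fun n x ↦ ?_⟩
  rw [expMul_apply, norm_mul, norm_cexp_mul]
  gcongr
  simpa using hC n x

theorem tendsto_expMul (hb : IsPlateauSequence b v) (s : ℂ) {x : ℝ} (hx : x ≤ 0) :
    Tendsto (fun n ↦ expMul s (b n) x) atTop (𝓝 (v * Complex.exp (s * x))) := by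
  refine tendsto_const_nhds.congr' ?_
  filter_upwards [(tendsto_natCast_atTop_atTop (R := ℝ)).eventually_gt_atTop (-x)] with n hn
  rw [expMul_apply, hb.eq_const n x (by linarith) (by linarith)]

theorem exists_norm_conv_le (hb : IsPlateauSequence b v) {Y : Distr ℝ} {T : 𝓢'(ℝ, ℂ)}
    (hT : Extends T Y) (hY : supp Y ⊆ Ici 0) {s : ℂ} (hs : 0 < s.re) :
    ∃ C : ℝ, ∀ n x, ‖conv Y (expMul s (b n)) x‖ ≤ C * Real.exp (s.re * x) := by
  obtain ⟨C, -, hC⟩ := exists_tempered_mul_bound T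
    (hb.uniformlySmooth.comp_const_sub (κ := ℕ × ℝ) Prod.fst Prod.snd) (kernel s)
  refine ⟨C, fun n x ↦ ?_⟩
  rw [conv_expMul hT hY, norm_mul, norm_cexp_mul, mul_comm]
  gcongr
  refine hC (n, x) _ fun ξ ↦ ?_
  rw [coe_kernel hs]
  rfl

/-- On truncations of `e^{s·}` the operator `Y *` acts in the limit as multiplication by the Laplace
transform at `s`. -/
theorem tendsto_conv (hb : IsPlateauSequence b v) {Y : Distr ℝ} {T : 𝓢'(ℝ, ℂ)}
    (hT : Extends T Y) (hY : supp Y ⊆ Ici 0) {s : ℂ} (hs : 0 < s.re) {x : ℝ} (hx : x ≤ 0) :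
    Tendsto (fun n ↦ conv Y (expMul s (b n)) x) atTop
      (𝓝 (Complex.exp (s * x) * (v * T (kernel s)))) := by
  simp_rw [conv_expMul hT hY]
  refine Tendsto.const_mul _ (tendsto_tempered_mul T
    (hb.uniformlySmooth.comp_const_sub (fun n : ℕ ↦ n) (fun _ ↦ x)) (kernel s) v _
    (fun n ξ ↦ ?_) x (fun n ξ hξ ↦ ?_))
  · rw [coe_kernel hs]
    rfl
  · have e : toSchwartz (kernelMul s (b n) x) ξ = b n (x - ξ) * kernelFun s ξ := rfl
    rw [e, coe_kernel hs]
    -- for `ξ ≤ -2` the kernel vanishes, and for `ξ > -2` the point `x - ξ` lies in `(-n, 2)`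
    rcases le_or_gt ξ (-2) with h | h
    · simp [kernelFun, step_of_nonpos (show ξ + 2 ≤ 0 by linarith)]
    · rw [hb.eq_const n (x - ξ) (by linarith [(abs_lt.1 hξ).2]) (by linarith)]

end IsPlateauSequence

theorem integrableOn_exp_sq {σ : ℝ} (hσ : 0 < σ) :
    IntegrableOn (fun τ : ℝ ↦ Real.exp (σ * τ) ^ 2) (Iic 0) := by
  have e : (fun τ : ℝ ↦ Real.exp (σ * τ) ^ 2) = fun τ ↦ Real.exp (2 * σ * τ) := by
    ext τ
    rw [← Real.exp_nat_mul]
    congr 1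
    push_cast
    ring
  rw [e]
  exact integrableOn_exp_mul_Iic (by positivity) 0

theorem integral_exp_sq_pos {σ : ℝ} (hσ : 0 < σ) :
    0 < ∫ τ in Iic (0 : ℝ), Real.exp (σ * τ) ^ 2 := by
  rw [integral_pos_iff_support_of_nonneg (fun τ ↦ sq_nonneg _) (integrableOn_exp_sq hσ)]
  have : Function.support (fun τ : ℝ ↦ Real.exp (σ * τ) ^ 2) = univ := by
    ext τ
    simp [Real.exp_ne_zero]
  simp [this]

/-- The inequality for the Laplace transform: pseudo-passivity up to time `0` on truncations of
`e^{sτ}` becomes, in the limit, the claimed inequality times `∫_{-∞}^0 e^{2 Re s τ} dτ`. -/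
theorem IsPseudoPassive.laplace_inequality {Y : Distr ℝ} {T : 𝓢'(ℝ, ℂ)} (hT : Extends T Y)
    (hY : supp Y ⊆ Ici 0) {N : ℕ} {c d : Fin (N + 1) → ℝ} (hp : IsPseudoPassive Y N c d)
    {s : ℂ} (hs : 0 < s.re) :
    ∑ j : Fin (N + 1), ‖s‖ ^ (2 * (j : ℕ)) * (c j + d j * ‖T (kernel s)‖ ^ 2)
      ≤ (T (kernel s)).re := by
  let W : ℂ := T (kernel s)
  let E : ℝ → ℝ := fun τ ↦ Real.exp (s.re * τ)
  have hE : IntegrableOn (fun τ ↦ E τ ^ 2) (Iic 0) := integrableOn_exp_sq hs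
  let φ : ℕ → Test ℝ := fun n ↦ expMul s (plateauTest n)
  have hleft : ∀ j : Fin (N + 1), Tendsto (fun n ↦ ∫ τ in Iic (0 : ℝ),
      (c j * ‖(derivTest^[j] (φ n)) τ‖ ^ 2 + d j * ‖conv Y (derivTest^[j] (φ n)) τ‖ ^ 2)) atTop
      (𝓝 (∫ τ in Iic (0 : ℝ), ‖s‖ ^ (2 * (j : ℕ)) * (c j + d j * ‖W‖ ^ 2) * E τ ^ 2)) := by
    intro j
    obtain ⟨b, hb, hφ⟩ := isPlateauSequence_plateauTest.iterate s j
    rw [mul_one] at hb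
    obtain ⟨A, hA⟩ := hb.exists_norm_expMul_le s
    obtain ⟨B, hB⟩ := hb.exists_norm_conv_le hT hY hs
    simp only [φ, hφ]
    refine tendsto_integral_of_dominated_convergence
      (fun τ ↦ (|c j| * A ^ 2 + |d j| * B ^ 2) * E τ ^ 2) (fun n ↦ ?_) (hE.const_mul _)
      (fun n ↦ Eventually.of_forall fun τ ↦ ?_) ?_
    · refine Continuous.aestronglyMeasurable ?_
      have h1 := (expMul s (b n)).continuous
      have h2 := continuous_conv Y (expMul s (b n))
      fun_prop
    · refine (norm_add_le _ _).trans ?_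
      rw [norm_mul, norm_mul, norm_pow, norm_pow, norm_norm, norm_norm, Real.norm_eq_abs,
        Real.norm_eq_abs, add_mul, mul_assoc, mul_assoc, ← mul_pow, ← mul_pow]
      gcongr
      exacts [hA n τ, hB n τ]
    · filter_upwards [ae_restrict_mem measurableSet_Iic] with τ hτ
      have h := (((hb.tendsto_expMul s hτ).norm.pow 2).const_mul (c j)).add
        (((hb.tendsto_conv hT hY hs hτ).norm.pow 2).const_mul (d j))
      convert h using 2
      simp only [norm_mul, norm_pow, norm_cexp_mul, W, E]
      ring
  have hright : Tendsto (fun n ↦ ∫ τ in Iic (0 : ℝ), starRingEnd ℂ (φ n τ) * conv Y (φ n) τ) atTop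
      (𝓝 (∫ τ in Iic (0 : ℝ), W * (E τ ^ 2 : ℝ))) := by
    have hb := isPlateauSequence_plateauTest
    obtain ⟨A, hA⟩ := hb.exists_norm_expMul_le s
    obtain ⟨B, hB⟩ := hb.exists_norm_conv_le hT hY hs
    refine tendsto_integral_of_dominated_convergence
      (fun τ ↦ (A * B) * E τ ^ 2) (fun n ↦ ?_) (hE.const_mul _)
      (fun n ↦ Eventually.of_forall fun τ ↦ ?_) ?_
    · refine Continuous.aestronglyMeasurable ?_
      exact (Complex.continuous_conj.comp (φ n).continuous).mul (continuous_conv Y (φ n))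
    · rw [norm_mul, RCLike.norm_conj, sq, mul_mul_mul_comm]
      exact mul_le_mul (hA n τ) (hB n τ) (norm_nonneg _) ((norm_nonneg _).trans (hA n τ))
    · filter_upwards [ae_restrict_mem measurableSet_Iic] with τ hτ
      have h := ((Complex.continuous_conj.tendsto _).comp (hb.tendsto_expMul s hτ)).mul
        (hb.tendsto_conv hT hY hs hτ)
      convert h using 2
      · rfl
      rw [one_mul, one_mul, ← mul_assoc, ← Complex.normSq_eq_conj_mul_self,
        Complex.normSq_eq_norm_sq, norm_cexp_mul, mul_comm]
  have hlim := le_of_tendsto_of_tendsto' (tendsto_finsetSum Finset.univ fun j _ ↦ hleft j)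
    ((Complex.continuous_re.tendsto _).comp hright) fun n ↦ hp.conv_inequality hT (φ n) 0
  simp only [integral_const_mul] at hlim
  rw [← Finset.sum_mul, integral_complex_ofReal, Complex.re_mul_ofReal] at hlim
  exact le_of_mul_le_mul_right hlim (integral_exp_sq_pos hs)

/-- For real `x` the truncations of `e^{xτ}` are real, hence so are their images under `Y *`,
whose values at `0` tend to the Laplace transform at `x`. -/
theorem laplace_im_eq_zero {Y : Distr ℝ} {T : 𝓢'(ℝ, ℂ)} (hT : Extends T Y)
    (hY : supp Y ⊆ Ici 0) {N : ℕ} {c d : Fin (N + 1) → ℝ} (hp : IsPseudoPassive Y N c d)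
    (hr : IsRealOperator Y) {x : ℝ} (hx : 0 < x) : (T (kernel x)).im = 0 := by
  have h := isPlateauSequence_plateauTest.tendsto_conv hT hY (s := (x : ℂ)) (by simpa using hx)
    (le_refl (0 : ℝ))
  rw [Complex.ofReal_zero, mul_zero, Complex.exp_zero, one_mul, one_mul] at h
  refine tendsto_nhds_unique ((Complex.continuous_im.tendsto _).comp h)
    (tendsto_const_nhds.congr fun n ↦ ?_)
  obtain ⟨ψ, hψ, hconv, -⟩ := hp (expMul x (plateauTest n))
  refine (hconv.conv_im_eq_zero hT (hr _ _ ?_ hconv) 0).symm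
  intro f hf
  rw [regular_apply (expMul _ _).continuous.locallyIntegrable]
  have e : ∀ t, f t * expMul x (plateauTest n) t
      = (((f t).re * ((plateau (n + 1) 3 t).re * Real.exp (x * t)) : ℝ) : ℂ) := by
    intro t
    have h1 : f t = ((f t).re : ℂ) := Complex.ext rfl (by simp [hf])
    have h2 : plateauTest n t = ((plateau (n + 1) 3 t).re : ℂ) :=
      Complex.ext rfl (plateau_im _ _ _)
    rw [expMul_apply, h2, h1]
    push_cast
    rfl
  simp_rw [e]
  rw [integral_complex_ofReal, Complex.ofReal_im]

end PseudoPassive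

end

theorem mainTheorem1 (Y : PseudoPassive.Distr ℝ) (N : ℕ) (c d : Fin (N + 1) → ℝ)
    (hY : PseudoPassive.IsPseudoPassiveCausalSlowGrowth Y N c d) :
    ∃ W : ℂ → ℂ,
      (∀ s : ℂ, 0 < s.re → PseudoPassive.HasLaplaceAt Y s (W s)) ∧
      DifferentiableOn ℂ W {s : ℂ | 0 < s.re} ∧
      (∀ s : ℂ, 0 < s.re →
        ∑ j : Fin (N + 1), ‖s‖ ^ (2 * (j : ℕ)) * (c j + d j * ‖W s‖ ^ 2) ≤ (W s).re) ∧
      (PseudoPassive.IsRealOperator Y → ∀ x : ℝ, 0 < x → (W (x : ℂ)).im = 0) := by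
  obtain ⟨T, hT⟩ := hY.slowGrowth
  exact ⟨fun s ↦ T (PseudoPassive.kernel s),
    fun s hs ↦ PseudoPassive.hasLaplaceAt_kernel hT hY.causal hs,
    PseudoPassive.differentiableOn_tempered_kernel T,
    fun s hs ↦ hY.pseudoPassive.laplace_inequality hT hY.causal hs,
    fun hr x hx ↦ PseudoPassive.laplace_im_eq_zero hT hY.causal hY.pseudoPassive hr hx⟩
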